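/- Let $N=\|\cdot\|$ be a norm on $\mathbb{R}^3$ which is smooth ($C^\infty$ away from the origin) and strictly convex, and whose unit sphere $\partial B$ has nowhere vanishing (usual) Gaussian curvature; let $B=\{x:\|x\|\le 1\}$, and let $V_3$ denote Lebesgue measure on $\mathbb{R}^3$. Let $M$ be a compact smooth surface without boundary, smoothly embedded in $\mathbb{R}^3$, which encloses a convex region, i.e. $M=\partial \mathcal K$ for a compact convex set $\mathcal K\subset\mathbb{R}^3$ with non-empty interior. Let $\eta:M\to\partial B$ be the outward Birkhoff-Gauss map: $\eta(p)$ is the vector with $\|\eta(p)\|=1$, pointing out of $\mathcal K$, which is Birkhoff orthogonal to $T_pM$, i.e. $\|\eta(p)\|\le\|\eta(p)+tw\|$ for all $w\in T_pM$, $t\in\mathbb{R}$. Identify $T_{\eta(p)}\partial B$ with $T_pM$ (these planes are parallel), put $K(p)=\det(d\eta_p)$ and $H(p)=\tfrac12\operatorname{tr}(d\eta_p)$ (Minkowski Gaussian and mean curvature), let $\omega(X,Y)=\det(X,Y,\eta)$ be the area element of $M$ (with $M$ oriented so that $\omega$ is positive), and let $\lambda_M(M)=\int_M\omega$ be the Minkowski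 surface area of $M$. Then for every $\rho\ge 0$ (in particular for small $\rho$) $$V_3(\mathcal K+\rho B)=V_3(\mathcal K)+\rho\,\lambda_M(M)+\rho^2\int_M H\,\omega+\frac{\rho^3}{3}\int_M K\,\omega .$$ Moreover, let $V_j(M,B)$, $0\le j\le 3$, be the (non-normalized) intrinsic volumes, i.e. the mixed volume of $j$ copies of $\mathcal K$ and $3-j$ copies of $B$, where the mixed volume of convex bodies $A_1,A_2,A_3$ is $\frac1{3!}\sum_{\emptyset\ne I\subseteq\{1,2,3\}}(-1)^{3-|I|}V_3\big(\sum_{i\in I}A_i\big)$. Then the Steiner formula $$V_3(\mathcal K+\rho B)=\sum_{j=0}^3\rho^{3-j}\binom3j V_j(M,B)\qquad(\rho\ge 0)$$ holds, and its coefficients are the following Minkowski quantities of $M$: $$V_3(M,B)=V_3(\mathcal K),\quad 3V_2(M,B)=\lambda_M(M),\quad 3V_1(M,B)=\int_M H\,\omega,\quad 3V_0(M,B)=\int_M K\,\omega .$$ In particular, up to the binomial factor $3$, $V_2(M,B)$ is the Minkowski surface area of $M$. -/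

import Mathlib

open MeasureTheory
open scoped Manifold ContDiff Pointwise

noncomputable section

namespace NormedSurface

/-- The ambient space `ℝ³`, with its usual inner product and Lebesgue measure. -/
abbrev E3 := EuclideanSpace ℝ (Fin 3)

/-- The model plane `ℝ²` of surfaces. -/
abbrev E2 := EuclideanSpace ℝ (Fin 2)

/-- The determinant `det(X, Y, Z)` of three vectors of `ℝ³`. -/
def det3 (X Y Z : E3) : ℝ := Matrix.det (fun i j : Fin 3 => (![X, Y, Z] i) j)

section Norm

/-- The unit ball `B` of the norm `N`. -/
def unitBall (N : Seminorm ℝ E3) : Set E3 := {x | N x ≤ 1}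

/-- The Euclidean unit normal `∇N / |∇N|` of the level surfaces of `N`, pointing outward. On the unit
sphere `{N = 1}` it is the usual Gauss map of that sphere. -/
def sphereNormal (N : Seminorm ℝ E3) (x : E3) : E3 :=
  ‖gradient (fun z => N z) x‖⁻¹ • gradient (fun z => N z) x

/-- The tangent plane at `x` of the level surface of `N` through `x`. -/
def sphereTangent (N : Seminorm ℝ E3) (x : E3) : Submodule ℝ E3 :=
  (Submodule.span ℝ {sphereNormal N x})ᗮ

/-- The differential of the usual Gauss map at `x`, as an endomorphism of the tangent plane
(the derivative of a unit normal field is tangent, so the projection changes nothing). -/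
def sphereWeingarten (N : Seminorm ℝ E3) (x : E3) :
    sphereTangent N x →ₗ[ℝ] sphereTangent N x :=
  (((sphereTangent N x).orthogonalProjectionOnto).comp
    ((fderiv ℝ (sphereNormal N) x).comp (sphereTangent N x).subtypeL)).toLinearMap

/-- The usual (Euclidean) Gaussian curvature of the unit sphere of `N` at a point `x` of it. -/
def sphereGaussCurvature (N : Seminorm ℝ E3) (x : E3) : ℝ :=
  LinearMap.det (sphereWeingarten N x)

/-- `N` is a smooth and strictly convex norm whose unit sphere has nowhere vanishing
(usual) Gaussian curvature. -/
structure IsAdmissibleNorm (N : Seminorm ℝ E3) : Prop where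
  definite : ∀ x, N x = 0 → x = 0
  smooth : ContDiffOn ℝ ∞ (fun x => N x) {0}ᶜ
  strictConvex : StrictConvex ℝ (unitBall N)
  curvature_ne_zero : ∀ x, N x = 1 → sphereGaussCurvature N x ≠ 0

/-- `v` is Birkhoff orthogonal to the plane `P`. -/
def BirkhoffOrthogonal (N : Seminorm ℝ E3) (v : E3) (P : Submodule ℝ E3) : Prop :=
  ∀ w ∈ P, ∀ t : ℝ, N v ≤ N (v + t • w)

end Norm

section Surface

variable {M : Type*} [TopologicalSpace M] [ChartedSpace E2 M]

/-- The tangent plane `f_*(T_pM)` of the immersed surface `f` at `p`, as a subspace of `ℝ³`. -/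
def tangentPlane (f : M → E3) (p : M) : Submodule ℝ E3 :=
  LinearMap.range (mfderiv (𝓡 2) 𝓘(ℝ, E3) f p).toLinearMap

/-- `v` is the outward pointing Birkhoff normal at `p` of the surface `f` bounding the region `K`:
a unit vector of the norm, Birkhoff orthogonal to the tangent plane, which points out of `K`. -/
def IsOuterBirkhoffNormal (N : Seminorm ℝ E3) (f : M → E3) (K : Set E3) (p : M) (v : E3) : Prop :=
  N v = 1 ∧ BirkhoffOrthogonal N v (tangentPlane f p) ∧
    ∀ᶠ t : ℝ in nhdsWithin 0 (Set.Ioi 0), f p + t • v ∉ K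

/-- The (outward pointing) Birkhoff-Gauss map `η` of the surface `f` bounding the region `K`. -/
def birkhoffGauss (N : Seminorm ℝ E3) (f : M → E3) (K : Set E3) (p : M) : E3 :=
  Classical.epsilon (IsOuterBirkhoffNormal N f K p)

/-- The differential `dη_p` of the Birkhoff-Gauss map as an endomorphism of `T_pM`. The tangent
plane of the unit sphere at `η p` is parallel to `f_*(T_pM)`, hence `dη_p` takes its values in
`f_*(T_pM)`, which is identified with `T_pM` by the inverse of the injective map `f_*`; the choice
of the left inverse of `f_*` on all of `ℝ³` is immaterial. -/
def shapeOperator (N : Seminorm ℝ E3) (f : M → E3) (K : Set E3) (p : M) :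
    TangentSpace (𝓡 2) p →ₗ[ℝ] TangentSpace (𝓡 2) p :=
  (LinearMap.leftInverse (mfderiv (𝓡 2) 𝓘(ℝ, E3) f p).toLinearMap).comp
    (mfderiv (𝓡 2) 𝓘(ℝ, E3) (birkhoffGauss N f K) p).toLinearMap

/-- The Minkowski Gaussian curvature `det (dη_p)`. -/
def gaussCurvature (N : Seminorm ℝ E3) (f : M → E3) (K : Set E3) (p : M) : ℝ :=
  LinearMap.det (shapeOperator N f K p)

/-- The Minkowski mean curvature `tr (dη_p) / 2`. -/
def meanCurvature (N : Seminorm ℝ E3) (f : M → E3) (K : Set E3) (p : M) : ℝ :=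
  (1 / 2) * LinearMap.trace ℝ (TangentSpace (𝓡 2) p) (shapeOperator N f K p)

/-- The density `|ω(φ_u, φ_v)| = |det(φ_u, φ_v, η)|` of the area element in the local
parametrization `φ = f ∘ e⁻¹` given by the chart `e`. (The surface is oriented so that `ω` is
positive; the absolute value allows charts of either orientation.) -/
def areaDensity (N : Seminorm ℝ E3) (f : M → E3) (K : Set E3)
    (e : OpenPartialHomeomorph M E2) (y : E2) : ℝ :=
  |det3 (fderiv ℝ (fun z => f (e.symm z)) y (EuclideanSpace.single 0 1))
    (fderiv ℝ (fun z => f (e.symm z)) y (EuclideanSpace.single 1 1))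
    (birkhoffGauss N f K (e.symm y))|

/-- The integral `∫_M g ω` of a function `g` against the area element `ω(X, Y) = det(X, Y, η)`,
computed with charts `e i` and a partition of unity `χ` subordinate to their domains. -/
def surfaceIntegral (N : Seminorm ℝ E3) (f : M → E3) (K : Set E3) {ι : Type*}
    (χ : SmoothPartitionOfUnity ι (𝓡 2) M) (e : ι → OpenPartialHomeomorph M E2)
    (g : M → ℝ) : ℝ :=
  ∑ᶠ i, ∫ y in (e i).target,
    χ i ((e i).symm y) * g ((e i).symm y) * areaDensity N f K (e i) y

/-- The Minkowski surface area `λ_M(M) = ∫_M ω`. -/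
def surfaceArea (N : Seminorm ℝ E3) (f : M → E3) (K : Set E3) {ι : Type*}
    (χ : SmoothPartitionOfUnity ι (𝓡 2) M) (e : ι → OpenPartialHomeomorph M E2) : ℝ :=
  surfaceIntegral N f K χ e (fun _ => 1)

end Surface

section MixedVolumes

/-- The mixed volume `V(A₀, A₁, A₂)` of three convex bodies of `ℝ³`, i.e. the polarization of the
volume: `(1/3!) ∑_I (-1)^(3 - |I|) vol(∑_{i ∈ I} A_i)`, over the nonempty `I ⊆ {0, 1, 2}`. -/
def mixedVolume (A : Fin 3 → Set E3) : ℝ :=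
  (1 / 6) * ∑ I ∈ (Finset.univ : Finset (Finset (Fin 3))).erase ∅,
    (-1 : ℝ) ^ (3 - I.card) * volume.real (∑ i ∈ I, A i)

/-- The (non-normalized) intrinsic volume `V_j(K, B)`: the mixed volume of `j` copies of `K` and
`3 - j` copies of `B`. -/
def intrinsicVolume (j : ℕ) (K B : Set E3) : ℝ :=
  mixedVolume (fun i => if (i : ℕ) < j then K else B)

end MixedVolumes

end NormedSurface

end

open NormedSurface

namespace NormedSurface

open Filter Topology Set

/-! The tube map `(p, t) ↦ f p + t • η p` is a bijection from `M × (0, ∞)` onto the complement of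
`K`, and the points with `t ≤ ρ` fill exactly `(K + ρB) \ K`. In a chart its Jacobian is `det(1 + t
dη) · det(φ_u, φ_v, η)`, whose first factor is `1 + 2tH + t²G`, with `H`, `G` the mean and Gaussian
curvatures. Change of variables, integration over `0 < t ≤ ρ` and summation over a partition of
unity give the tube formula (`volume_tube`).

The main tool is the covector `dN` at `η p`. It satisfies `dN ≤ N` with equality at `η p`, and it
supports `K` at `f p` (`supports_birkhoffGauss`). Hence `f p + t • η p` has `N`-distance exactly `t`
from `K`. Strict convexity then gives injectivity of the tube map, and separating `K` from the ball
that touches it at a nearest point gives surjectivity (`tube_injective`, `exists_tube_eq`).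

Nonvanishing curvature of the unit sphere is used twice. It makes `x ↦ N(x) dN(x)` a local
diffeomorphism, so `η` is as smooth as the conormal of the surface (`contDiffAt_birkhoffGauss`). It
also makes the Hessian of `N` positive definite on tangent planes, which together with the convexity
of `K` keeps the Jacobian factor positive (`tube_jacobian_pos`), so that no absolute value spoils
the polynomial.

For the Steiner formula, convexity turns every Minkowski sum in the polarization into a dilate of a
parallel body, so the mixed volumes are read off from the volume polynomial. This requires its
leading coefficient to be the volume of `B`, which follows from growth as `ρ → ∞`
(`leading_coeff_eq_volume`). -/

theorem continuous_seminorm (N : Seminorm ℝ E3) : Continuous N :=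
  N.convexOn.locallyLipschitz.continuous

/-- If the increments of two differentiable maps have nonnegative pairing near a point, so do
their differentials. -/
theorem fderiv_pairing_nonneg {V : Type*} [NormedAddCommGroup V] [NormedSpace ℝ V]
    {n : V → E3 →L[ℝ] ℝ} {φ : V → E3} {n' : V →L[ℝ] E3 →L[ℝ] ℝ} {φ' : V →L[ℝ] E3} {y : V}
    (hn : HasFDerivAt n n' y) (hφ : HasFDerivAt φ φ' y)
    (h : ∀ᶠ z in 𝓝 y, 0 ≤ (n z - n y) (φ z - φ y)) (X : V) : 0 ≤ n' X (φ' X) := by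
  have hl : HasDerivAt (fun t : ℝ => y + t • X) X 0 := by
    simpa using ((hasDerivAt_id (0 : ℝ)).smul_const X).const_add y
  have h1 : HasDerivAt (fun t : ℝ => n (y + t • X)) (n' X) 0 :=
    HasFDerivAt.comp_hasDerivAt (0 : ℝ) (by simpa using hn) hl
  have h2 : HasDerivAt (fun t : ℝ => φ (y + t • X)) (φ' X) 0 :=
    HasFDerivAt.comp_hasDerivAt (0 : ℝ) (by simpa using hφ) hl
  have hev : ∀ᶠ t : ℝ in 𝓝[>] 0, 0 ≤ (n (y + t • X) - n y) (φ (y + t • X) - φ y) :=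
    nhdsWithin_le_nhds ((by simpa using hl.continuousAt.tendsto :
      Tendsto (fun t : ℝ => y + t • X) (𝓝 0) (𝓝 y)).eventually h)
  -- The pairing of the two difference quotients is the given nonnegative pairing divided by `t²`.
  have hlim := (isBoundedBilinearMap_apply (𝕜 := ℝ) (E := E3) (F := ℝ)).continuous.continuousAt
    |>.tendsto.comp
      (Tendsto.prodMk_nhds h1.tendsto_slope_zero_right h2.tendsto_slope_zero_right)
  refine ge_of_tendsto hlim ?_
  filter_upwards [hev, self_mem_nhdsWithin] with t ht (ht0 : 0 < t)
  simp only [Function.comp_apply, zero_add, zero_smul, add_zero, map_smul, smul_apply, smul_eq_mul]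
  positivity

/-! ### First and second differential of the norm -/

namespace IsAdmissibleNorm

variable {N : Seminorm ℝ E3}

theorem pos (hN : IsAdmissibleNorm N) {x : E3} (hx : x ≠ 0) : 0 < N x :=
  lt_of_le_of_ne (apply_nonneg N x) fun h => hx (hN.definite x h.symm)

theorem ne_zero {x : E3} (hx : N x = 1) : x ≠ 0 := by
  rintro rfl; simp at hx

theorem contDiffAt (hN : IsAdmissibleNorm N) {x : E3} (hx : x ≠ 0) : ContDiffAt ℝ ∞ N x :=
  hN.smooth.contDiffAt (isOpen_compl_singleton.mem_nhds hx)

theorem hasFDerivAt (hN : IsAdmissibleNorm N) {x : E3} (hx : x ≠ 0) :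
    HasFDerivAt N (fderiv ℝ N x) x :=
  ((hN.contDiffAt hx).differentiableAt (by simp)).hasFDerivAt

theorem contDiffAt_fderiv (hN : IsAdmissibleNorm N) {x : E3} (hx : x ≠ 0) :
    ContDiffAt ℝ ∞ (fderiv ℝ N) x :=
  (hN.contDiffAt hx).fderiv_right (m := ∞) (by simp)

theorem hasFDerivAt_fderiv (hN : IsAdmissibleNorm N) {x : E3} (hx : x ≠ 0) :
    HasFDerivAt (fderiv ℝ N) (fderiv ℝ (fderiv ℝ N) x) x :=
  ((hN.contDiffAt_fderiv hx).differentiableAt (by simp)).hasFDerivAt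

theorem hasDerivAt_line (hN : IsAdmissibleNorm N) {x : E3} (hx : x ≠ 0) (u : E3) :
    HasDerivAt (fun t : ℝ => N (x + t • u)) (fderiv ℝ N x u) 0 := by
  have hl : HasDerivAt (fun t : ℝ => x + t • u) u 0 := by
    simpa using ((hasDerivAt_id (0 : ℝ)).smul_const u).const_add x
  exact HasFDerivAt.comp_hasDerivAt (0 : ℝ) (by simpa using hN.hasFDerivAt hx) hl

/-- Euler's identity for a function homogeneous of degree one. -/
theorem fderiv_self (hN : IsAdmissibleNorm N) {x : E3} (hx : x ≠ 0) : fderiv ℝ N x x = N x := by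
  refine (hN.hasDerivAt_line hx x).unique ?_
  have h : HasDerivAt (fun t : ℝ => (1 + t) * N x) (N x) 0 := by
    simpa using ((hasDerivAt_id (0 : ℝ)).const_add 1).mul_const (N x)
  refine h.congr_of_eventuallyEq ?_
  filter_upwards [lt_mem_nhds (show (-1 : ℝ) < 0 by norm_num)] with t ht
  rw [show x + t • x = (1 + t) • x by rw [add_smul, one_smul], map_smul_eq_mul,
    Real.norm_of_nonneg (by linarith)]

/-- Subadditivity bounds the difference quotients. With Euler's identity, `dN` at `x` has dual norm
one, attained in the direction of `x`. -/
theorem fderiv_le (hN : IsAdmissibleNorm N) {x : E3} (hx : x ≠ 0) (u : E3) :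
    fderiv ℝ N x u ≤ N u := by
  refine le_of_tendsto (hN.hasDerivAt_line hx u).tendsto_slope_zero_right ?_
  filter_upwards [self_mem_nhdsWithin] with t (ht : 0 < t)
  have h := map_add_le_add N x (t • u)
  rw [map_smul_eq_mul, Real.norm_of_nonneg ht.le] at h
  simp only [zero_add, zero_smul, add_zero, smul_eq_mul]
  rw [inv_mul_le_iff₀ ht]
  linarith

theorem fderiv_smul (x : E3) {c : ℝ} (hc : 0 < c) :
    fderiv ℝ N (c • x) = fderiv ℝ N x := by
  have h := fderiv_comp_smul (𝕜 := ℝ) (f := N) (x := x) c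
  have h2 : (fun z => N (c • z)) = c • (N : E3 → ℝ) := by
    ext z; simp [map_smul_eq_mul, abs_of_pos hc]
  rw [h2, fderiv_const_smul_field] at h
  exact (smul_right_injective _ hc.ne' h).symm

/-- Differentiate Euler's identity: the term `dN(X)` appears on both sides. -/
theorem sndFDeriv_self (hN : IsAdmissibleNorm N) {x : E3} (hx : x ≠ 0) (X : E3) :
    fderiv ℝ (fderiv ℝ N) x X x = 0 := by
  have h1 := (hN.hasFDerivAt_fderiv hx).clm_apply (hasFDerivAt_id x)
  have h2 : HasFDerivAt (fun z => fderiv ℝ N z (id z)) (fderiv ℝ N x) x :=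
    (hN.hasFDerivAt hx).congr_of_eventuallyEq
      (by filter_upwards [isOpen_compl_singleton.mem_nhds hx] with z hz using hN.fderiv_self hz)
  have := congr($(h1.unique h2) X)
  simpa using this

theorem sndFDeriv_symm (hN : IsAdmissibleNorm N) {x : E3} (hx : x ≠ 0) (X Y : E3) :
    fderiv ℝ (fderiv ℝ N) x X Y = fderiv ℝ (fderiv ℝ N) x Y X :=
  (hN.contDiffAt hx).isSymmSndFDerivAt (by simpa using WithTop.coe_le_coe.2 (le_top : (2 : ℕ∞) ≤ ⊤)) X Y

/-- The gradient of a convex function is monotone; here this is Euler's identity plus `dN ≤ N` at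
both points. -/
theorem sndFDeriv_nonneg (hN : IsAdmissibleNorm N) {x : E3} (hx : x ≠ 0) (X : E3) :
    0 ≤ fderiv ℝ (fderiv ℝ N) x X X := by
  refine fderiv_pairing_nonneg (hN.hasFDerivAt_fderiv hx) (hasFDerivAt_id x) ?_ X
  filter_upwards [isOpen_compl_singleton.mem_nhds hx] with z hz
  have h1 := hN.fderiv_le hx z
  have h2 := hN.fderiv_le hz x
  simp only [id, map_sub, sub_apply, hN.fderiv_self hx, hN.fderiv_self hz]
  linarith

/-- Nonvanishing curvature: the second differential is nondegenerate on tangent planes. -/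
theorem eq_zero_of_sndFDeriv_eq_zero (hN : IsAdmissibleNorm N) {x : E3} (hx : N x = 1) {X : E3}
    (h1 : fderiv ℝ N x X = 0) (h2 : fderiv ℝ (fderiv ℝ N) x X = 0) : X = 0 := by
  by_contra hX
  have hx0 := ne_zero hx
  -- The Riesz isomorphism, conjugate-linear in general, as a real-linear map that the chain rule
  -- accepts.
  let J : (E3 →L[ℝ] ℝ) →L[ℝ] E3 := LinearMap.toContinuousLinearMap
    { toFun := fun ℓ => (InnerProductSpace.toDual ℝ E3).symm ℓ
      map_add' := fun a b => map_add _ a b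
      map_smul' := fun c a => by simp }
  have hgrad : HasFDerivAt (gradient (fun z => N z))
      (J.comp (fderiv ℝ (fderiv ℝ N) x)) x :=
    J.hasFDerivAt.comp x
      (hN.hasFDerivAt_fderiv hx0)
  have hg0 : gradient (fun z => N z) x ≠ 0 := by
    intro h
    have : fderiv ℝ N x = 0 := by
      simpa [gradient] using h
    have h3 := hN.fderiv_self hx0
    rw [this, hx] at h3
    simp at h3
  have hnorm : DifferentiableAt ℝ (fun g : E3 => ‖g‖⁻¹ • g) (gradient (fun z => N z) x) :=
    ((differentiableAt_id.norm ℝ hg0).inv (norm_ne_zero_iff.2 hg0)).smul differentiableAt_id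
  have hS : fderiv ℝ (sphereNormal N) x X = 0 := by
    have := hnorm.hasFDerivAt.comp x hgrad
    rw [show sphereNormal N = (fun g : E3 => ‖g‖⁻¹ • g) ∘ gradient (fun z => N z) from rfl,
      this.fderiv]
    simp [h2]
  have hXT : X ∈ sphereTangent N x := by
    rw [sphereTangent, Submodule.mem_orthogonal_singleton_iff_inner_right, sphereNormal,
      inner_smul_left, gradient, InnerProductSpace.toDual_symm_apply]
    have h1' : (fderiv ℝ (fun z => N z) x) X = 0 := h1
    rw [h1', mul_zero]
  refine hN.curvature_ne_zero x hx ?_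
  rw [sphereGaussCurvature]
  by_contra hdet
  have hinj := (LinearMap.equivOfDetNeZero _ hdet).injective
  have h0 : (⟨X, hXT⟩ : sphereTangent N x) = 0 := hinj (by
    simp [LinearMap.equivOfDetNeZero, sphereWeingarten, hS])
  exact hX (congrArg Subtype.val h0)

/-- An isotropic vector of a semidefinite form lies in its kernel, and nonvanishing curvature leaves
no tangent vector there. -/
theorem sndFDeriv_pos (hN : IsAdmissibleNorm N) {x : E3} (hx : N x = 1) {X : E3}
    (h1 : fderiv ℝ N x X = 0) (hX : X ≠ 0) : 0 < fderiv ℝ (fderiv ℝ N) x X X := by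
  have hx0 := ne_zero hx
  refine lt_of_le_of_ne (hN.sndFDeriv_nonneg hx0 X) fun h => hX ?_
  refine hN.eq_zero_of_sndFDeriv_eq_zero hx h1 ?_
  ext Y
  set b := fderiv ℝ (fderiv ℝ N) x
  have key : ∀ s : ℝ, 0 ≤ 2 * s * b X Y + s ^ 2 * b Y Y := fun s => by
    have := hN.sndFDeriv_nonneg hx0 (X + s • Y)
    have hs := hN.sndFDeriv_symm hx0 X Y
    change b X Y = b Y X at hs
    change 0 ≤ b _ _ at this
    simp only [map_add, map_smul, add_apply, smul_apply,
      smul_eq_mul, ← h, ← hs] at this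
    linarith
  have hY : 0 ≤ b Y Y := hN.sndFDeriv_nonneg hx0 Y
  change b X Y = 0
  by_contra hne
  -- The minimizer would have denominator `b Y Y`; adding one avoids division by zero and still
  -- makes the value negative.
  have := key (-(b X Y) / (b Y Y + 1))
  have hp : 0 < b Y Y + 1 := by linarith
  have h3 : 2 * (-(b X Y) / (b Y Y + 1)) * b X Y + (-(b X Y) / (b Y Y + 1)) ^ 2 * b Y Y
      = -((b X Y) ^ 2 * (b Y Y + 2)) / (b Y Y + 1) ^ 2 := by
    field_simp; ring
  rw [h3] at this
  have h4 : 0 < (b X Y) ^ 2 * (b Y Y + 2) / (b Y Y + 1) ^ 2 := by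
    have := sq_pos_of_ne_zero hne
    positivity
  rw [neg_div] at this
  linarith

/-- Strict convexity: a functional attains its maximum over the ball at one point only. -/
theorem maximizer_unique (hN : IsAdmissibleNorm N) {ℓ : E3 →L[ℝ] ℝ} (hℓ : ∀ u, ℓ u ≤ N u)
    {v w : E3} (hv : N v = 1) (hw : N w = 1) (hv1 : ℓ v = 1) (hw1 : ℓ w = 1) : v = w := by
  by_contra hne
  set m := (1 / 2 : ℝ) • v + (1 / 2 : ℝ) • w
  have hm : m ∈ interior (unitBall N) :=
    hN.strictConvex (show N v ≤ 1 from hv.le) (show N w ≤ 1 from hw.le) hne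
      (by norm_num) (by norm_num) (by norm_num)
  have hm1 : ℓ m = 1 := by simp [m, hv1, hw1]; norm_num
  -- The midpoint is interior, so a slight dilation of it stays in the ball, yet `ℓ` exceeds 1
  -- there.
  have hl : Tendsto (fun t : ℝ => (1 + t) • m) (𝓝[>] 0) (𝓝 m) := by
    have : Continuous (fun t : ℝ => (1 + t) • m) := by fun_prop
    simpa using (this.tendsto 0).mono_left nhdsWithin_le_nhds
  obtain ⟨t, ht, ht0⟩ := ((hl.eventually (isOpen_interior.mem_nhds hm)).and
    self_mem_nhdsWithin).exists
  have h1 : N ((1 + t) • m) ≤ 1 := (interior_subset : interior (unitBall N) ⊆ _) ht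
  have h2 := hℓ ((1 + t) • m)
  have ht0 : 0 < t := ht0
  simp only [map_smul, smul_eq_mul, hm1] at h2
  linarith

/-- The map `x ↦ N(x) dN(x)` has smooth local inverses. -/
theorem exists_localInverse (hN : IsAdmissibleNorm N) {x : E3} (hx : N x = 1) :
    ∃ L : (E3 →L[ℝ] ℝ) → E3, ContDiffAt ℝ ∞ L (fderiv ℝ N x) ∧ L (fderiv ℝ N x) = x ∧
      ∀ᶠ m in 𝓝 (fderiv ℝ N x), N (L m) • fderiv ℝ N (L m) = m := by
  have hx0 := ne_zero hx
  -- `dN` alone is constant along rays, hence degenerate; the factor `N` restores the radial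
  -- direction.
  set G : E3 → E3 →L[ℝ] ℝ := fun z => N z • fderiv ℝ N z
  have hG : ContDiffAt ℝ ∞ G x := (hN.contDiffAt hx0).smul (hN.contDiffAt_fderiv hx0)
  have hGx : G x = fderiv ℝ N x := by simp [G, hx]
  have hG' := (hN.hasFDerivAt hx0).fun_smul (hN.hasFDerivAt_fderiv hx0)
  set G' := N x • fderiv ℝ (fderiv ℝ N) x + (fderiv ℝ N x).smulRight (fderiv ℝ N x)
  have hG'a : ∀ X, G' X = fderiv ℝ (fderiv ℝ N) x X + fderiv ℝ N x X • fderiv ℝ N x := by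
    intro X; simp [G', hx]
  have hinj : Function.Injective G' := by
    rw [injective_iff_map_eq_zero]
    intro X hX
    rw [hG'a] at hX
    have h1 : fderiv ℝ N x X = 0 := by
      have := congr($hX x)
      simpa [hN.sndFDeriv_self hx0, hN.fderiv_self hx0, hx] using this
    exact hN.eq_zero_of_sndFDeriv_eq_zero hx h1 (by simpa [h1] using hX)
  have hdim : Module.finrank ℝ E3 = Module.finrank ℝ (E3 →L[ℝ] ℝ) :=
    (InnerProductSpace.toDual ℝ E3).toLinearEquiv.finrank_eq
  have : FiniteDimensional ℝ (E3 →L[ℝ] ℝ) :=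
    (InnerProductSpace.toDual ℝ E3).toLinearEquiv.finiteDimensional
  set Ge : E3 ≃L[ℝ] (E3 →L[ℝ] ℝ) :=
    (LinearEquiv.ofInjectiveOfFinrankEq (G' : E3 →ₗ[ℝ] (E3 →L[ℝ] ℝ)) hinj
      hdim).toContinuousLinearEquiv
  have hGe : HasFDerivAt G (Ge : E3 →L[ℝ] (E3 →L[ℝ] ℝ)) x := by
    have h : (Ge : E3 →L[ℝ] (E3 →L[ℝ] ℝ)) = G' := by ext; rfl
    rw [h]
    exact hG'
  refine ⟨hG.localInverse hGe (by simp), ?_, ?_, ?_⟩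
  · simpa [hGx] using hG.to_localInverse hGe (by simp)
  · simpa [hGx] using hG.localInverse_apply_image hGe (n := ∞) (by simp)
  · have := (hG.hasStrictFDerivAt' hGe (by simp)).eventually_right_inverse
    rw [hGx] at this
    exact this

theorem fderiv_eq_of_smul_eq (hN : IsAdmissibleNorm N) {x : E3} (hx : x ≠ 0) :
    fderiv ℝ N ((N x)⁻¹ • x) = fderiv ℝ N x :=
  fderiv_smul x (inv_pos.2 (hN.pos hx))

/-- Equivalence with the Euclidean norm. -/
theorem exists_norm_le (hN : IsAdmissibleNorm N) : ∃ C : ℝ, 0 < C ∧ ∀ x, ‖x‖ ≤ C * N x := by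
  obtain ⟨z, hz, hmin⟩ := (isCompact_sphere (0 : E3) 1).exists_isMinOn
    (NormedSpace.sphere_nonempty.2 zero_le_one) (continuous_seminorm N).continuousOn
  have hz0 : z ≠ 0 := by rintro rfl; simp at hz
  refine ⟨(N z)⁻¹, inv_pos.2 (hN.pos hz0), fun x => ?_⟩
  rcases eq_or_ne x 0 with rfl | hx
  · simp
  have h : N z ≤ N (‖x‖⁻¹ • x) := hmin (by simp [norm_smul, hx])
  rw [map_smul_eq_mul, norm_inv, norm_norm, ← div_eq_inv_mul,
    le_div_iff₀ (norm_pos_iff.2 hx)] at h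
  rw [← div_eq_inv_mul, le_div_iff₀ (hN.pos hz0)]
  linarith

theorem isCompact_unitBall (hN : IsAdmissibleNorm N) : IsCompact (unitBall N) := by
  obtain ⟨C, hC, h⟩ := hN.exists_norm_le
  refine Metric.isCompact_of_isClosed_isBounded
    (isClosed_le (continuous_seminorm N) continuous_const) ?_
  refine (Metric.isBounded_closedBall (x := (0 : E3)) (r := C)).subset fun x hx => ?_
  have hx : N x ≤ 1 := hx
  rw [mem_closedBall_zero_iff]
  nlinarith [h x]

end IsAdmissibleNorm

/-! ### Supporting functionals and parallel bodies -/

/-- A nonzero functional whose maximum over `K` is attained at `x`. -/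
structure Supports (K : Set E3) (x : E3) (ℓ : E3 →L[ℝ] ℝ) : Prop where
  ne_zero : ℓ ≠ 0
  le : ∀ y ∈ K, ℓ y ≤ ℓ x

theorem Supports.exists_pos {K : Set E3} {x : E3} {ℓ : E3 →L[ℝ] ℝ} (h : Supports K x ℓ) :
    ∃ z, 0 < ℓ z := by
  obtain ⟨z, hz⟩ := DFunLike.ne_iff.1 h.ne_zero
  rcases lt_or_gt_of_ne hz with h1 | h1
  · exact ⟨-z, by simpa using h1⟩
  · exact ⟨z, h1⟩

theorem Supports.apply_pos {K : Set E3} {N : Seminorm ℝ E3} {x v : E3} {ℓ : E3 →L[ℝ] ℝ}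
    (hℓ : Supports K x ℓ) (hv : ∀ u, ℓ u ≤ ℓ v * N u) : 0 < ℓ v := by
  obtain ⟨z, hz⟩ := hℓ.exists_pos
  by_contra hc
  nlinarith [hv z, apply_nonneg N z]

theorem Supports.lt_of_mem_interior {K : Set E3} {x : E3} {ℓ : E3 →L[ℝ] ℝ} (h : Supports K x ℓ)
    {c : E3} (hc : c ∈ interior K) : ℓ c < ℓ x := by
  obtain ⟨z, hz⟩ := h.exists_pos
  have hl : Tendsto (fun t : ℝ => c + t • z) (𝓝[>] 0) (𝓝 c) := by
    have : Continuous (fun t : ℝ => c + t • z) := by fun_prop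
    simpa using (this.tendsto 0).mono_left nhdsWithin_le_nhds
  obtain ⟨t, ht, ht0⟩ := ((hl.eventually (mem_interior_iff_mem_nhds.1 hc)).and
    self_mem_nhdsWithin).exists
  have h1 := h.le _ ht
  have ht0 : 0 < t := ht0
  simp only [map_add, map_smul, smul_eq_mul] at h1
  nlinarith [mul_pos ht0 hz]

theorem exists_supports {K : Set E3} (hK : IsCompact K) (hconv : Convex ℝ K)
    (hint : (interior K).Nonempty) {x : E3} (hx : x ∉ interior K) : ∃ ℓ, Supports K x ℓ := by
  obtain ⟨ℓ, hℓ⟩ := geometric_hahn_banach_open_point hconv.interior isOpen_interior hx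
  refine ⟨ℓ, ?_, fun y hy => ?_⟩
  · rintro rfl
    obtain ⟨c, hc⟩ := hint
    simpa using hℓ c hc
  · have : y ∈ closure (interior K) := by
      rw [hconv.closure_interior_eq_closure_of_nonempty_interior hint, hK.isClosed.closure_eq]
      exact hy
    have hcl : IsClosed {y | ℓ y ≤ ℓ x} := isClosed_le ℓ.continuous continuous_const
    exact closure_minimal (fun a ha => (hℓ a ha).le) hcl this

/-- The unit vector where `ℓ` attains its dual norm. For a supporting `ℓ` it will be the Birkhoff
normal. -/
theorem IsAdmissibleNorm.exists_maximizer {N : Seminorm ℝ E3} (hN : IsAdmissibleNorm N) {ℓ : E3 →L[ℝ] ℝ} (hℓ : ∃ z, 0 < ℓ z) :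
    ∃ v, N v = 1 ∧ ∀ u, ℓ u ≤ ℓ v * N u := by
  obtain ⟨v, hv, hmax⟩ := hN.isCompact_unitBall.exists_isMaxOn
    ⟨0, by simp [unitBall]⟩ ℓ.continuous.continuousOn
  have hle : ∀ u, ℓ u ≤ ℓ v * N u := by
    intro u
    rcases eq_or_ne u 0 with rfl | hu
    · simp
    have hp := hN.pos hu
    have : ℓ ((N u)⁻¹ • u) ≤ ℓ v := hmax (by
      simp [unitBall, map_smul_eq_mul, abs_of_pos hp, hp.ne'])
    rw [map_smul, smul_eq_mul, ← div_eq_inv_mul, div_le_iff₀ hp] at this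
    exact this
  have hpos : 0 < ℓ v := by
    obtain ⟨z, hz⟩ := hℓ
    by_contra hc
    nlinarith [hle z, apply_nonneg N z]
  have hv : N v ≤ 1 := hv
  refine ⟨v, le_antisymm hv ?_, hle⟩
  have := hle v
  nlinarith

theorem mem_add_smul_unitBall {N : Seminorm ℝ E3} {K : Set E3} (hN : IsAdmissibleNorm N) {ρ : ℝ} (hρ : 0 ≤ ρ)
    {x : E3} : x ∈ K + ρ • unitBall N ↔ ∃ y ∈ K, N (x - y) ≤ ρ := by
  constructor
  · rintro ⟨y, hy, _, ⟨u, hu, rfl⟩, rfl⟩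
    refine ⟨y, hy, ?_⟩
    have hu : N u ≤ 1 := hu
    simp only [add_sub_cancel_left, map_smul_eq_mul, Real.norm_of_nonneg hρ]
    nlinarith
  · rintro ⟨y, hy, hle⟩
    refine ⟨y, hy, x - y, ?_, by simp⟩
    rcases hρ.eq_or_lt with rfl | hρ
    · have := hN.definite _ (le_antisymm hle (apply_nonneg N _))
      rw [this]
      exact ⟨0, by simp [unitBall], by simp⟩
    · refine ⟨ρ⁻¹ • (x - y), ?_, by simp [hρ.ne']⟩
      simp only [unitBall, mem_ofPred_eq, map_smul_eq_mul, norm_inv, Real.norm_of_nonneg hρ.le]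
      rw [inv_mul_le_iff₀ hρ]
      linarith

/-! ### Differentiation in charts -/

section Charts

variable {M : Type*} [TopologicalSpace M] [ChartedSpace E2 M]

theorem mdifferentiable_of_mem_maximalAtlas {e : OpenPartialHomeomorph M E2}
    (he : e ∈ IsManifold.maximalAtlas (𝓡 2) ∞ M) : e.MDifferentiable (𝓡 2) (𝓡 2) :=
  ⟨(contMDiffOn_of_mem_maximalAtlas he).mdifferentiableOn (by simp),
    (contMDiffOn_symm_of_mem_maximalAtlas he).mdifferentiableOn (by simp)⟩

/-- The differential of the inverse of a chart. -/
noncomputable def chartEquiv {e : OpenPartialHomeomorph M E2}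
    (he : e ∈ IsManifold.maximalAtlas (𝓡 2) ∞ M) {y : E2} (hy : y ∈ e.target) :
    E2 ≃L[ℝ] TangentSpace (𝓡 2) (e.symm y) :=
  (mdifferentiable_of_mem_maximalAtlas he).symm.mfderiv hy

theorem hasFDerivAt_comp_symm {e : OpenPartialHomeomorph M E2}
    (he : e ∈ IsManifold.maximalAtlas (𝓡 2) ∞ M) {y : E2} (hy : y ∈ e.target) {g : M → E3}
    (hg : MDifferentiableAt (𝓡 2) 𝓘(ℝ, E3) g (e.symm y)) :
    HasFDerivAt (fun z => g (e.symm z))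
      ((mfderiv (𝓡 2) 𝓘(ℝ, E3) g (e.symm y)).comp
        (chartEquiv he hy : E2 →L[ℝ] TangentSpace (𝓡 2) (e.symm y))) y := by
  have h1 := hg.hasMFDerivAt.comp y
    ((mdifferentiable_of_mem_maximalAtlas he).symm.mdifferentiableAt hy).hasMFDerivAt
  exact hasMFDerivAt_iff_hasFDerivAt.1 h1

theorem contDiffAt_comp_symm {e : OpenPartialHomeomorph M E2}
    (he : e ∈ IsManifold.maximalAtlas (𝓡 2) ∞ M) {y : E2} (hy : y ∈ e.target) {f : M → E3}
    (hf : ContMDiff (𝓡 2) 𝓘(ℝ, E3) ∞ f) : ContDiffAt ℝ ∞ (fun z => f (e.symm z)) y :=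
  contMDiffAt_iff_contDiffAt.1
    (hf.contMDiffAt.comp y (contMDiffAt_symm_of_mem_maximalAtlas he hy))

theorem mdifferentiableAt_of_comp_symm {e : OpenPartialHomeomorph M E2}
    (he : e ∈ IsManifold.maximalAtlas (𝓡 2) ∞ M) {y : E2} (hy : y ∈ e.target) {g : M → E3}
    (hg : ContDiffAt ℝ ∞ (fun z => g (e.symm z)) y) :
    MDifferentiableAt (𝓡 2) 𝓘(ℝ, E3) g (e.symm y) := by
  have hp : e.symm y ∈ e.source := e.map_target hy
  have h1 : MDifferentiableAt (𝓡 2) 𝓘(ℝ, E3) (fun z => g (e.symm z)) (e (e.symm y)) := by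
    rw [e.right_inv hy]
    exact (hg.differentiableAt (by simp)).mdifferentiableAt
  have h2 := h1.comp (e.symm y)
    ((mdifferentiable_of_mem_maximalAtlas he).mdifferentiableAt hp)
  refine h2.congr_of_eventuallyEq ?_
  filter_upwards [e.open_source.mem_nhds hp] with q hq
  simp [e.left_inv hq]

end Charts

/-- The surface `f`, smoothly embedded, bounds the convex body `K`. -/
structure BoundsConvexBody {M : Type*} [TopologicalSpace M] [ChartedSpace E2 M]
    (f : M → E3) (K : Set E3) : Prop where
  contMDiff : ContMDiff (𝓡 2) 𝓘(ℝ, E3) ∞ f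
  mfderiv_injective : ∀ p, Function.Injective (mfderiv (𝓡 2) 𝓘(ℝ, E3) f p)
  injective : Function.Injective f
  isCompact : IsCompact K
  convex : Convex ℝ K
  interior_nonempty : (interior K).Nonempty
  range_eq : range f = frontier K

/-! ### Birkhoff normals correspond to supporting functionals -/

namespace BoundsConvexBody

variable {M : Type*} [TopologicalSpace M] [ChartedSpace E2 M]
  {f : M → E3} {K : Set E3} {N : Seminorm ℝ E3}

theorem mem (h : BoundsConvexBody f K) (p : M) : f p ∈ K :=
  h.isCompact.isClosed.frontier_subset (h.range_eq ▸ mem_range_self p)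

theorem notMem_interior (h : BoundsConvexBody f K) (p : M) : f p ∉ interior K :=
  (h.range_eq ▸ mem_range_self p : f p ∈ frontier K).2

theorem finrank_tangentPlane (h : BoundsConvexBody f K) (p : M) :
    Module.finrank ℝ (tangentPlane f p) = 2 := by
  have h1 := LinearMap.finrank_range_of_inj
    (f := (mfderiv (𝓡 2) 𝓘(ℝ, E3) f p).toLinearMap) (h.mfderiv_injective p)
  have h2 : Module.finrank ℝ (TangentSpace (𝓡 2) p) = 2 := finrank_euclideanSpace_fin (𝕜 := ℝ)
  exact h1.trans h2

/-- The tangent plane is the kernel of every nonzero functional vanishing on it. -/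
theorem tangentPlane_eq_ker (h : BoundsConvexBody f K) {p : M} {ℓ : E3 →L[ℝ] ℝ} (hℓ : ℓ ≠ 0)
    (h0 : ∀ w ∈ tangentPlane f p, ℓ w = 0) : tangentPlane f p = LinearMap.ker ℓ.toLinearMap := by
  refine Submodule.eq_of_le_of_finrank_le (fun w hw => h0 w hw) ?_
  have h1 := Module.Dual.finrank_ker_add_one_of_ne_zero (f := ℓ.toLinearMap)
    (by rintro h; exact hℓ (by ext x; exact congr($h x)))
  have h2 : Module.finrank ℝ E3 = 3 := finrank_euclideanSpace_fin
  rw [h.finrank_tangentPlane p]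
  omega

theorem exists_eq_smul (h : BoundsConvexBody f K) {p : M} {ℓ m : E3 →L[ℝ] ℝ} (hℓ : ℓ ≠ 0)
    (h0 : ∀ w ∈ tangentPlane f p, ℓ w = 0) (h1 : ∀ w ∈ tangentPlane f p, m w = 0) :
    ∃ c : ℝ, m = c • ℓ := by
  rw [h.tangentPlane_eq_ker hℓ h0] at h1
  obtain ⟨z, hz⟩ := DFunLike.ne_iff.1 hℓ
  have hz : ℓ z ≠ 0 := hz
  refine ⟨m z / ℓ z, ?_⟩
  ext x
  have := h1 (x - (ℓ x / ℓ z) • z) (by simp [hz])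
  simp only [map_sub, map_smul, smul_eq_mul, smul_apply] at this ⊢
  field_simp at this ⊢
  linarith

variable [IsManifold (𝓡 2) ∞ M]

/-- Fermat: `ℓ ∘ f` is maximal at `p`, so its differential vanishes. -/
theorem apply_tangent (h : BoundsConvexBody f K) {p : M} {ℓ : E3 →L[ℝ] ℝ}
    (hℓ : Supports K (f p) ℓ) {w : E3} (hw : w ∈ tangentPlane f p) : ℓ w = 0 := by
  obtain ⟨v, rfl⟩ := hw
  obtain ⟨e, he, hp⟩ : ∃ e ∈ IsManifold.maximalAtlas (𝓡 2) ∞ M, p ∈ e.source :=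
    ⟨chartAt E2 p, IsManifold.chart_mem_maximalAtlas p, mem_chart_source E2 p⟩
  obtain ⟨y, hy, rfl⟩ : ∃ y ∈ e.target, e.symm y = p := ⟨e p, e.map_source hp, e.left_inv hp⟩
  have hd := ℓ.hasFDerivAt.comp y (hasFDerivAt_comp_symm he hy
    (h.contMDiff.mdifferentiable (by simp) (e.symm y)))
  have hmax : IsLocalMax (ℓ ∘ fun z => f (e.symm z)) y :=
    Eventually.of_forall fun z => hℓ.le _ (h.mem _)
  have := congr($(hmax.hasFDerivAt_eq_zero hd) ((chartEquiv he hy).symm v))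
  change ℓ (mfderiv (𝓡 2) 𝓘(ℝ, E3) f (e.symm y)
    (chartEquiv he hy ((chartEquiv he hy).symm v))) = 0 at this
  rwa [ContinuousLinearEquiv.apply_symm_apply] at this

/-- The annihilator of the tangent plane is a line, and an interior point of `K` fixes the sign. -/
theorem supports_pos_smul (h : BoundsConvexBody f K) {p : M} {ℓ m : E3 →L[ℝ] ℝ}
    (hℓ : Supports K (f p) ℓ) (hm : Supports K (f p) m) : ∃ c : ℝ, 0 < c ∧ m = c • ℓ := by
  obtain ⟨c, rfl⟩ := h.exists_eq_smul hℓ.ne_zero (fun w => h.apply_tangent hℓ)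
    (fun w => h.apply_tangent hm)
  refine ⟨c, ?_, rfl⟩
  obtain ⟨x, hx⟩ := h.interior_nonempty
  have h1 := hℓ.lt_of_mem_interior hx
  have h2 := hm.lt_of_mem_interior hx
  simp only [smul_apply, smul_eq_mul] at h2
  by_contra hc
  nlinarith

theorem isOuterBirkhoffNormal_of_supports (h : BoundsConvexBody f K) {p : M} {ℓ : E3 →L[ℝ] ℝ}
    (hℓ : Supports K (f p) ℓ) {v : E3} (hv1 : N v = 1) (hv : ∀ u, ℓ u ≤ ℓ v * N u) :
    IsOuterBirkhoffNormal N f K p v := by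
  have hpos := hℓ.apply_pos hv
  refine ⟨hv1, fun w hw t => ?_, ?_⟩
  · have := hv (v + t • w)
    rw [map_add, map_smul, h.apply_tangent hℓ hw, smul_zero, add_zero] at this
    rw [hv1]
    exact le_of_mul_le_mul_left (by linarith) hpos
  · filter_upwards [self_mem_nhdsWithin] with t (ht : 0 < t) hmem
    have := hℓ.le _ hmem
    simp only [map_add, map_smul, smul_eq_mul] at this
    nlinarith [mul_pos ht hpos]

/-- A vector pointing out of the body at `f p` is on the outer side of the tangent plane. -/
theorem apply_nonneg_of_outward (h : BoundsConvexBody f K) {p : M} {ℓ : E3 →L[ℝ] ℝ}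
    (hℓ : Supports K (f p) ℓ) {v : E3} (hv : ∀ᶠ t : ℝ in 𝓝[>] 0, f p + t • v ∉ K) :
    0 ≤ ℓ v := by
  -- By convexity, a ray from a point of `K` that leaves `K` at once never returns.
  have hray : ∀ t : ℝ, 0 < t → f p + t • v ∉ K := by
    intro t ht hmem
    have hmem2 : ∀ᶠ s : ℝ in 𝓝[>] 0, f p + s • v ∈ K := by
      filter_upwards [Ioo_mem_nhdsGT ht] with s hs
      have := h.convex (h.mem p) hmem (a := 1 - s / t) (b := s / t)
        (by rw [sub_nonneg, div_le_one ht]; exact hs.2.le) (div_nonneg hs.1.le ht.le) (by ring)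
      convert this using 1
      rw [smul_add, smul_smul, div_mul_cancel₀ _ ht.ne', ← add_assoc, ← add_smul]
      simp
    obtain ⟨s, h1, h2⟩ := (hv.and hmem2).exists
    exact h1 h2
  have hc : Convex ℝ ((fun t : ℝ => f p + t • v) '' Ioi 0) := by
    rintro _ ⟨s, hs, rfl⟩ _ ⟨t, ht, rfl⟩ a b ha hb hab
    refine ⟨a * s + b * t, (convex_Ioi (0 : ℝ)) hs ht ha hb hab, ?_⟩
    have : b = 1 - a := by linarith
    subst this
    module
  -- A functional separating `K` from the ray supports `K` at `f p`, so it is a positive multiple of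
  -- `ℓ`.
  obtain ⟨m, u, hm1, hm2⟩ := geometric_hahn_banach_open h.convex.interior isOpen_interior hc
    (by
      rw [Set.disjoint_left]
      rintro _ hx ⟨t, ht, rfl⟩
      exact hray t ht (interior_subset hx))
  have hu : u ≤ m (f p) := by
    have hl : Tendsto (fun t : ℝ => m (f p + t • v)) (𝓝[>] 0) (𝓝 (m (f p))) := by
      have : Continuous (fun t : ℝ => m (f p + t • v)) := by fun_prop
      simpa using (this.tendsto 0).mono_left nhdsWithin_le_nhds
    refine ge_of_tendsto hl ?_
    filter_upwards [self_mem_nhdsWithin] with t ht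
    exact hm2 _ ⟨t, ht, rfl⟩
  have hKu : ∀ y ∈ K, m y ≤ u := by
    intro y hy
    have hy' : y ∈ closure (interior K) := by
      rw [h.convex.closure_interior_eq_closure_of_nonempty_interior h.interior_nonempty,
        h.isCompact.isClosed.closure_eq]
      exact hy
    have hcl : IsClosed {y | m y ≤ u} := isClosed_le m.continuous continuous_const
    exact closure_minimal (fun a ha => (hm1 a ha).le) hcl hy'
  have hm : Supports K (f p) m := by
    refine ⟨?_, fun y hy => (hKu y hy).trans hu⟩
    rintro rfl
    obtain ⟨x, hx⟩ := h.interior_nonempty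
    have h1 := hm1 x hx
    have h2 := hm2 _ ⟨1, mem_Ioi.2 one_pos, rfl⟩
    simp only [zero_apply] at h1 h2
    linarith
  have hmv : 0 ≤ m v := by
    have h1 := hKu _ (h.mem p)
    have h2 := hm2 _ ⟨1, mem_Ioi.2 one_pos, rfl⟩
    simp only [one_smul, map_add] at h2
    linarith
  obtain ⟨c, hc, rfl⟩ := h.supports_pos_smul hℓ hm
  simp only [smul_apply, smul_eq_mul] at hmv
  by_contra hneg
  nlinarith

/-- Birkhoff orthogonality makes `t ↦ N (v + t • w)` minimal at 0, so `dN` at `v` kills the tangent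
plane. It is thus a multiple of a supporting functional, positive because `v` points outward. -/
theorem supports_fderiv_of_isOuterBirkhoffNormal (hN : IsAdmissibleNorm N)
    (h : BoundsConvexBody f K) {p : M} {v : E3} (hv : IsOuterBirkhoffNormal N f K p v) :
    Supports K (f p) (fderiv ℝ N v) := by
  obtain ⟨hv1, hv2, hv3⟩ := hv
  have hv0 := IsAdmissibleNorm.ne_zero hv1
  obtain ⟨ℓ, hℓ⟩ := exists_supports h.isCompact h.convex h.interior_nonempty (h.notMem_interior p)
  have hT : ∀ w ∈ tangentPlane f p, fderiv ℝ N v w = 0 := by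
    intro w hw
    have hmin : IsLocalMin (fun t : ℝ => N (v + t • w)) 0 :=
      Eventually.of_forall fun t => by simpa using hv2 w hw t
    exact hmin.hasDerivAt_eq_zero (hN.hasDerivAt_line hv0 w)
  obtain ⟨c, hc⟩ := h.exists_eq_smul hℓ.ne_zero (fun w => h.apply_tangent hℓ) hT
  have h1 := hN.fderiv_self hv0
  rw [hv1] at h1
  have h2 := h.apply_nonneg_of_outward hℓ hv3
  rw [hc] at h1 ⊢
  simp only [smul_apply, smul_eq_mul] at h1
  have hc0 : 0 < c := by
    by_contra hneg
    nlinarith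
  refine ⟨?_, fun y hy => ?_⟩
  · exact smul_ne_zero hc0.ne' hℓ.ne_zero
  · simp only [smul_apply, smul_eq_mul]
    exact mul_le_mul_of_nonneg_left (hℓ.le y hy) hc0.le

theorem birkhoffGauss_spec (hN : IsAdmissibleNorm N) (h : BoundsConvexBody f K) (p : M) :
    IsOuterBirkhoffNormal N f K p (birkhoffGauss N f K p) := by
  obtain ⟨ℓ, hℓ⟩ := exists_supports h.isCompact h.convex h.interior_nonempty (h.notMem_interior p)
  obtain ⟨v, hv1, hv⟩ := hN.exists_maximizer hℓ.exists_pos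
  exact Classical.epsilon_spec (p := IsOuterBirkhoffNormal N f K p)
    ⟨v, h.isOuterBirkhoffNormal_of_supports hℓ hv1 hv⟩

theorem norm_birkhoffGauss (hN : IsAdmissibleNorm N) (h : BoundsConvexBody f K) (p : M) :
    N (birkhoffGauss N f K p) = 1 := (h.birkhoffGauss_spec hN p).1

theorem birkhoffGauss_ne_zero (hN : IsAdmissibleNorm N) (h : BoundsConvexBody f K) (p : M) :
    birkhoffGauss N f K p ≠ 0 := IsAdmissibleNorm.ne_zero (h.norm_birkhoffGauss hN p)

theorem supports_birkhoffGauss (hN : IsAdmissibleNorm N) (h : BoundsConvexBody f K) (p : M) :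
    Supports K (f p) (fderiv ℝ N (birkhoffGauss N f K p)) :=
  h.supports_fderiv_of_isOuterBirkhoffNormal hN (h.birkhoffGauss_spec hN p)

theorem fderiv_birkhoffGauss_self (hN : IsAdmissibleNorm N) (h : BoundsConvexBody f K) (p : M) :
    fderiv ℝ N (birkhoffGauss N f K p) (birkhoffGauss N f K p) = 1 := by
  rw [hN.fderiv_self (h.birkhoffGauss_ne_zero hN p), h.norm_birkhoffGauss hN p]

/-- Supporting functionals at `f p` are proportional, and strict convexity allows only one unit
vector where they attain their norm. -/
theorem eq_birkhoffGauss_of_supports (hN : IsAdmissibleNorm N) (h : BoundsConvexBody f K) {p : M}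
    {ℓ : E3 →L[ℝ] ℝ} (hℓ : Supports K (f p) ℓ) {v : E3} (hv1 : N v = 1)
    (hv : ∀ u, ℓ u ≤ ℓ v * N u) : v = birkhoffGauss N f K p := by
  obtain ⟨c, hc, rfl⟩ := h.supports_pos_smul (h.supports_birkhoffGauss hN p) hℓ
  have hle := hN.fderiv_le (h.birkhoffGauss_ne_zero hN p)
  have h1 := h.norm_birkhoffGauss hN p
  have h2 := h.fderiv_birkhoffGauss_self hN p
  refine hN.maximizer_unique hle hv1 h1 (le_antisymm (by simpa [hv1] using hle v) ?_) h2
  have := hv (birkhoffGauss N f K p)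
  simp only [smul_apply, smul_eq_mul, h1, h2] at this
  nlinarith

/-! ### The tube map `(p, t) ↦ f p + t η p` -/

/-- Evaluate `dN` at the normal on the difference: the support property gives at least `t`, and `dN
≤ N`. -/
theorem le_norm_tube_sub (hN : IsAdmissibleNorm N) (h : BoundsConvexBody f K) (p : M) {t : ℝ}
    {y : E3} (hy : y ∈ K) : t ≤ N (f p + t • birkhoffGauss N f K p - y) := by
  have h1 := (h.supports_birkhoffGauss hN p).le y hy
  have h2 := hN.fderiv_le (h.birkhoffGauss_ne_zero hN p) (f p + t • birkhoffGauss N f K p - y)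
  simp only [map_add, map_sub, map_smul, h.fderiv_birkhoffGauss_self hN p, smul_eq_mul] at h2
  linarith

theorem tube_notMem (hN : IsAdmissibleNorm N) (h : BoundsConvexBody f K) (p : M) {t : ℝ}
    (ht : 0 < t) : f p + t • birkhoffGauss N f K p ∉ K := fun hmem => by
  have := h.le_norm_tube_sub hN p (t := t) hmem
  simp at this
  linarith

theorem tube_mem_add_iff (hN : IsAdmissibleNorm N) (h : BoundsConvexBody f K) (p : M) {t ρ : ℝ}
    (ht : 0 < t) (hρ : 0 ≤ ρ) :
    f p + t • birkhoffGauss N f K p ∈ K + ρ • unitBall N ↔ t ≤ ρ := by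
  rw [mem_add_smul_unitBall hN hρ]
  constructor
  · rintro ⟨y, hy, hle⟩
    exact (h.le_norm_tube_sub hN p hy).trans hle
  · intro hle
    refine ⟨f p, h.mem p, ?_⟩
    simpa [map_smul_eq_mul, h.norm_birkhoffGauss hN p, abs_of_pos ht] using hle

/-- Both heights are the distance of the common point to `K`, hence equal. Then `dN` at `η p` takes
a value at least 1 on `η q`, so the normals agree by strict convexity, and with them the feet. -/
theorem tube_injective (hN : IsAdmissibleNorm N) (h : BoundsConvexBody f K) {p q : M} {s t : ℝ}
    (hs : 0 < s) (ht : 0 < t)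
    (heq : f p + s • birkhoffGauss N f K p = f q + t • birkhoffGauss N f K q) :
    p = q ∧ s = t := by
  have hst : s = t := by
    refine le_antisymm ?_ ?_
    · have := h.le_norm_tube_sub hN p (t := s) (h.mem q)
      rw [heq] at this
      simpa [map_smul_eq_mul, h.norm_birkhoffGauss hN q, abs_of_pos ht] using this
    · have := h.le_norm_tube_sub hN q (t := t) (h.mem p)
      rw [← heq] at this
      simpa [map_smul_eq_mul, h.norm_birkhoffGauss hN p, abs_of_pos hs] using this
  subst hst
  refine ⟨?_, rfl⟩
  have hle := hN.fderiv_le (h.birkhoffGauss_ne_zero hN p)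
  have h1 := (h.supports_birkhoffGauss hN p).le _ (h.mem q)
  have h2 := congr(fderiv ℝ N (birkhoffGauss N f K p) $heq)
  simp only [map_add, map_smul, smul_eq_mul, h.fderiv_birkhoffGauss_self hN p] at h2
  have hq := h.norm_birkhoffGauss hN q
  have h3 := hN.maximizer_unique hle (h.norm_birkhoffGauss hN p) hq
    (h.fderiv_birkhoffGauss_self hN p) (le_antisymm (by simpa [hq] using hle (birkhoffGauss N f K q)) (by nlinarith))
  rw [h3] at heq
  exact h.injective (add_right_cancel heq)

/-- Take a point `y` of `K` nearest to `x` in `N` and separate `K` from the open ball about `x`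
reaching `y`. The separating functional, negated, supports `K` at `y` and attains its norm along `x
- y`, which is therefore normal. -/
theorem exists_tube_eq (hN : IsAdmissibleNorm N) (h : BoundsConvexBody f K) {x : E3}
    (hx : x ∉ K) : ∃ p, ∃ t : ℝ, 0 < t ∧ f p + t • birkhoffGauss N f K p = x := by
  obtain ⟨y, hy, hmin⟩ := h.isCompact.exists_isMinOn (h.interior_nonempty.mono interior_subset)
    (f := fun y => N (x - y)) (by
      exact ((continuous_seminorm N).comp (continuous_const.sub continuous_id)).continuousOn)
  have hxy : x - y ≠ 0 := fun h0 => hx (by rwa [sub_eq_zero.1 h0])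
  set t : ℝ := N (x - y) with ht_def
  have ht : 0 < t := hN.pos hxy
  set v := t⁻¹ • (x - y)
  have hv1 : N v = 1 := by
    simp only [v, map_smul_eq_mul, norm_inv, Real.norm_of_nonneg ht.le]
    exact inv_mul_cancel₀ ht.ne'
  have hxv : x = y + t • v := by simp [v, ht.ne']
  have hopen : IsOpen {z | N (x - z) < t} :=
    isOpen_lt ((continuous_seminorm N).comp (continuous_const.sub continuous_id)) continuous_const
  have hcb : Convex ℝ {z | N (x - z) < t} := by
    intro a ha b hb α β hα hβ hαβ
    have ha : N (x - a) < t := ha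
    have hb : N (x - b) < t := hb
    have h1 : x - (α • a + β • b) = α • (x - a) + β • (x - b) := by
      have : β = 1 - α := by linarith
      subst this; module
    have h2 := map_add_le_add N (α • (x - a)) (β • (x - b))
    simp only [map_smul_eq_mul, Real.norm_of_nonneg hα, Real.norm_of_nonneg hβ] at h2
    change N (x - (α • a + β • b)) < t
    rw [h1]
    rcases hα.eq_or_lt with rfl | hα
    · have : β = 1 := by linarith
      subst this; linarith
    · nlinarith [mul_lt_mul_of_pos_left ha hα, mul_le_mul_of_nonneg_left hb.le hβ]
  obtain ⟨ℓ, u, hℓ1, hℓ2⟩ := geometric_hahn_banach_open hcb hopen h.convex (by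
    rw [Set.disjoint_left]
    intro z hz hzK
    have h1 : N (x - z) < t := hz
    have h2 : t ≤ N (x - z) := hmin hzK
    linarith)
  have hball : ∀ w, N w < 1 → ℓ (x - t • w) < u := fun w hw => hℓ1 _ (by
    simp only [mem_ofPred_eq, sub_sub_cancel, map_smul_eq_mul, Real.norm_of_nonneg ht.le]
    nlinarith)
  have hball' : ∀ w, N w ≤ 1 → ℓ (x - t • w) ≤ u := by
    intro w hw
    have hl : Tendsto (fun s : ℝ => ℓ (x - t • (s • w))) (𝓝[<] 1) (𝓝 (ℓ (x - t • w))) := by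
      have : Continuous (fun s : ℝ => ℓ (x - t • (s • w))) := by fun_prop
      simpa using (this.tendsto 1).mono_left nhdsWithin_le_nhds
    refine le_of_tendsto hl ?_
    filter_upwards [Ioo_mem_nhdsLT (zero_lt_one (α := ℝ))] with s hs
    refine (hball _ ?_).le
    rw [map_smul_eq_mul, Real.norm_of_nonneg hs.1.le]
    nlinarith [hs.1, hs.2]
  have hyx : y = x - t • v := by rw [hxv]; simp
  have hyu : ℓ y = u := le_antisymm (hyx ▸ hball' v hv1.le) (hℓ2 y hy)
  have hsupp : Supports K y (-ℓ) := by
    refine ⟨?_, fun z hz => ?_⟩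
    · intro h0
      have h0 : ℓ = 0 := by simpa using h0
      have := hball 0 (by simp)
      rw [← hyu, h0] at this
      simp at this
    · have := hℓ2 z hz
      simp only [neg_apply]
      linarith
  have hbound : ∀ w, N w ≤ 1 → (-ℓ) w ≤ (-ℓ) v := by
    intro w hw
    have h1 := hball' w hw
    have h2 := hyu
    rw [← hyu, hyx] at h1
    simp only [map_sub, map_smul, smul_eq_mul, neg_apply] at h1 ⊢
    nlinarith
  have hbound' : ∀ w, (-ℓ) w ≤ (-ℓ) v * N w := by
    intro w
    rcases eq_or_ne w 0 with rfl | hw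
    · simp
    have hp := hN.pos hw
    have := hbound ((N w)⁻¹ • w) (by simp [map_smul_eq_mul, abs_of_pos hp, hp.ne'])
    rw [map_smul, smul_eq_mul, ← div_eq_inv_mul, div_le_iff₀ hp] at this
    exact this
  have hyf : y ∈ frontier K :=
    ⟨subset_closure hy, fun hyi => (hsupp.lt_of_mem_interior hyi).false⟩
  rw [← h.range_eq] at hyf
  obtain ⟨p, hp⟩ := hyf
  refine ⟨p, t, ht, ?_⟩
  rw [← h.eq_birkhoffGauss_of_supports hN (hp ▸ hsupp) hv1 hbound', hp]
  exact hxv.symm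

end BoundsConvexBody

/-! ### Determinants in coordinates -/

theorem det3_eq (X Y Z : E3) : det3 X Y Z =
    X 0 * (Y 1 * Z 2 - Y 2 * Z 1) - X 1 * (Y 0 * Z 2 - Y 2 * Z 0)
      + X 2 * (Y 0 * Z 1 - Y 1 * Z 0) := by
  change Matrix.det (Matrix.of fun i j : Fin 3 => (![X, Y, Z] i).ofLp j) = _
  rw [Matrix.det_fin_three]
  simp
  ring

/-- The functional `det(X, Y, ·)`. -/
noncomputable def normalForm (X Y : E3) : E3 →L[ℝ] ℝ :=
  (X 1 * Y 2 - X 2 * Y 1) • EuclideanSpace.proj (0 : Fin 3)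
    + (X 2 * Y 0 - X 0 * Y 2) • EuclideanSpace.proj (1 : Fin 3)
    + (X 0 * Y 1 - X 1 * Y 0) • EuclideanSpace.proj (2 : Fin 3)

theorem normalForm_apply (X Y Z : E3) : normalForm X Y Z = det3 X Y Z := by
  simp [det3_eq, normalForm]
  ring

theorem contDiff_normalForm : ContDiff ℝ ∞ (fun q : E3 × E3 => normalForm q.1 q.2) := by
  have h : ∀ i : Fin 3, ContDiff ℝ ∞ (fun q : E3 × E3 => q.1 i) := fun i =>
    (EuclideanSpace.proj i : E3 →L[ℝ] ℝ).contDiff.comp contDiff_fst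
  have h' : ∀ i : Fin 3, ContDiff ℝ ∞ (fun q : E3 × E3 => q.2 i) := fun i =>
    (EuclideanSpace.proj i : E3 →L[ℝ] ℝ).contDiff.comp contDiff_snd
  unfold normalForm
  exact (((((h 1).mul (h' 2)).sub ((h 2).mul (h' 1))).smul contDiff_const).add
    ((((h 2).mul (h' 0)).sub ((h 0).mul (h' 2))).smul contDiff_const)).add
    ((((h 0).mul (h' 1)).sub ((h 1).mul (h' 0))).smul contDiff_const)

theorem continuous_det3 : Continuous (fun q : E3 × E3 × E3 => det3 q.1 q.2.1 q.2.2) := by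
  simp only [det3_eq]
  fun_prop

theorem e2_eq (X : E2) :
    X = X 0 • EuclideanSpace.single 0 (1 : ℝ) + X 1 • EuclideanSpace.single 1 (1 : ℝ) := by
  ext i; fin_cases i <;> simp

/-- If `A` is injective into the kernel of `ℓ` and `ℓ Z ≠ 0`, then `det(A e₀, A e₁, Z) ≠ 0`. -/
theorem det3_ne_zero {A : E2 →L[ℝ] E3} (hA : Function.Injective A) {ℓ : E3 →L[ℝ] ℝ}
    (hℓ : ∀ X, ℓ (A X) = 0) {Z : E3} (hZ : ℓ Z ≠ 0) :
    det3 (A (EuclideanSpace.single 0 1)) (A (EuclideanSpace.single 1 1)) Z ≠ 0 := by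
  intro h0
  obtain ⟨v, hv0, hv⟩ := Matrix.exists_vecMul_eq_zero_iff.2 h0
  have hsum : A (v 0 • EuclideanSpace.single 0 1 + v 1 • EuclideanSpace.single 1 1)
      + v 2 • Z = 0 := by
    ext j
    have := congrFun hv j
    simp only [Matrix.vecMul, dotProduct, Fin.sum_univ_three] at this
    simpa using this
  have h2 : v 2 = 0 := by
    have := congrArg ℓ hsum
    simpa [map_add, hℓ, hZ] using this
  rw [h2, zero_smul, add_zero] at hsum
  have h3 := (injective_iff_map_eq_zero A).1 hA _ hsum
  apply hv0
  ext i
  fin_cases i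
  · simpa using congr($h3 0)
  · simpa using congr($h3 1)
  · exact h2

theorem linearMap_trace_e2 (T : E2 →ₗ[ℝ] E2) : LinearMap.trace ℝ E2 T =
    T (EuclideanSpace.single 0 1) 0 + T (EuclideanSpace.single 1 1) 1 := by
  rw [LinearMap.trace_eq_matrix_trace ℝ (EuclideanSpace.basisFun (Fin 2) ℝ).toBasis,
    Matrix.trace_fin_two]
  simp [LinearMap.toMatrix_apply]

theorem linearMap_det_e2 (T : E2 →ₗ[ℝ] E2) : LinearMap.det T =
    T (EuclideanSpace.single 0 1) 0 * T (EuclideanSpace.single 1 1) 1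
      - T (EuclideanSpace.single 1 1) 0 * T (EuclideanSpace.single 0 1) 1 := by
  rw [← LinearMap.det_toMatrix (EuclideanSpace.basisFun (Fin 2) ℝ).toBasis, Matrix.det_fin_two]
  simp [LinearMap.toMatrix_apply]

theorem linearMap_det_e3 (T : E3 →ₗ[ℝ] E3) : LinearMap.det T =
    det3 (T (EuclideanSpace.single 0 1)) (T (EuclideanSpace.single 1 1))
      (T (EuclideanSpace.single 2 1)) := by
  rw [← LinearMap.det_toMatrix (EuclideanSpace.basisFun (Fin 3) ℝ).toBasis, Matrix.det_fin_three,
    det3_eq]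
  simp [LinearMap.toMatrix_apply]
  ring

/-- `det(A e₀ + t A T e₀, A e₁ + t A T e₁, Z) = det(1 + t T) det(A e₀, A e₁, Z)`. -/
theorem det3_add_smul (A B : E2 →L[ℝ] E3) (T : E2 →ₗ[ℝ] E2) (hT : ∀ X, A (T X) = B X) (Z : E3)
    (t : ℝ) :
    det3 (A (EuclideanSpace.single 0 1) + t • B (EuclideanSpace.single 0 1))
      (A (EuclideanSpace.single 1 1) + t • B (EuclideanSpace.single 1 1)) Z
      = (1 + t * LinearMap.trace ℝ E2 T + t ^ 2 * LinearMap.det T)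
        * det3 (A (EuclideanSpace.single 0 1)) (A (EuclideanSpace.single 1 1)) Z := by
  have h : ∀ X, B X = (T X) 0 • A (EuclideanSpace.single 0 1)
      + (T X) 1 • A (EuclideanSpace.single 1 1) := by
    intro X
    rw [← hT, ← map_smul, ← map_smul, ← map_add, ← e2_eq]
  rw [h, h, linearMap_trace_e2, linearMap_det_e2]
  simp only [det3_eq, PiLp.add_apply, PiLp.smul_apply, smul_eq_mul]
  ring

theorem fderiv_comp_symm_apply {M : Type*} [TopologicalSpace M] [ChartedSpace E2 M]
    {e : OpenPartialHomeomorph M E2} (he : e ∈ IsManifold.maximalAtlas (𝓡 2) ∞ M) {y : E2}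
    (hy : y ∈ e.target) {g : M → E3}
    (hg : MDifferentiableAt (𝓡 2) 𝓘(ℝ, E3) g (e.symm y)) (X : E2) :
    fderiv ℝ (fun z => g (e.symm z)) y X
      = mfderiv (𝓡 2) 𝓘(ℝ, E3) g (e.symm y) (chartEquiv he hy X) := by
  rw [← mfderiv_eq_fderiv]
  exact congr($((hg.hasMFDerivAt.comp y ((mdifferentiable_of_mem_maximalAtlas
    he).symm.mdifferentiableAt hy).hasMFDerivAt).mfderiv) X)

/-! ### Smoothness of the Birkhoff-Gauss map and the Jacobian of the tube -/

namespace BoundsConvexBody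

variable {M : Type*} [TopologicalSpace M] [ChartedSpace E2 M]
  {f : M → E3} {K : Set E3} {N : Seminorm ℝ E3} {e : OpenPartialHomeomorph M E2} {y : E2}

theorem hasFDerivAt_chart (h : BoundsConvexBody f K)
    (he : e ∈ IsManifold.maximalAtlas (𝓡 2) ∞ M) (hy : y ∈ e.target) :
    HasFDerivAt (fun z => f (e.symm z)) ((mfderiv (𝓡 2) 𝓘(ℝ, E3) f (e.symm y)).comp
        (chartEquiv he hy : E2 →L[ℝ] TangentSpace (𝓡 2) (e.symm y))) y :=
  hasFDerivAt_comp_symm he hy (h.contMDiff.mdifferentiable (by simp) (e.symm y))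

theorem fderiv_chart_apply (h : BoundsConvexBody f K)
    (he : e ∈ IsManifold.maximalAtlas (𝓡 2) ∞ M) (hy : y ∈ e.target) (X : E2) :
    fderiv ℝ (fun z => f (e.symm z)) y X
      = mfderiv (𝓡 2) 𝓘(ℝ, E3) f (e.symm y) (chartEquiv he hy X) :=
  fderiv_comp_symm_apply he hy (h.contMDiff.mdifferentiable (by simp) (e.symm y)) X

theorem fderiv_chart_injective (h : BoundsConvexBody f K)
    (he : e ∈ IsManifold.maximalAtlas (𝓡 2) ∞ M) (hy : y ∈ e.target) :
    Function.Injective (fderiv ℝ (fun z => f (e.symm z)) y) := fun X Y hXY => by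
  rw [h.fderiv_chart_apply he hy, h.fderiv_chart_apply he hy] at hXY
  exact (chartEquiv he hy).injective (h.mfderiv_injective _ hXY)

theorem fderiv_chart_mem (h : BoundsConvexBody f K)
    (he : e ∈ IsManifold.maximalAtlas (𝓡 2) ∞ M) (hy : y ∈ e.target) (X : E2) :
    fderiv ℝ (fun z => f (e.symm z)) y X ∈ tangentPlane f (e.symm y) :=
  ⟨chartEquiv he hy X, (h.fderiv_chart_apply he hy X).symm⟩

theorem exists_fderiv_chart_eq (h : BoundsConvexBody f K)
    (he : e ∈ IsManifold.maximalAtlas (𝓡 2) ∞ M) (hy : y ∈ e.target) {w : E3}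
    (hw : w ∈ tangentPlane f (e.symm y)) : ∃ X, fderiv ℝ (fun z => f (e.symm z)) y X = w := by
  obtain ⟨v, rfl⟩ := hw
  refine ⟨(chartEquiv he hy).symm v, ?_⟩
  rw [h.fderiv_chart_apply he hy, ContinuousLinearEquiv.apply_symm_apply]
  rfl

/-- The (not normalized) normal covector of a local parametrization. -/
noncomputable def _root_.NormedSurface.chartNormal (f : M → E3) (e : OpenPartialHomeomorph M E2)
    (y : E2) : E3 →L[ℝ] ℝ :=
  normalForm (fderiv ℝ (fun z => f (e.symm z)) y (EuclideanSpace.single 0 1))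
    (fderiv ℝ (fun z => f (e.symm z)) y (EuclideanSpace.single 1 1))

theorem contDiffAt_chartNormal (h : BoundsConvexBody f K)
    (he : e ∈ IsManifold.maximalAtlas (𝓡 2) ∞ M) (hy : y ∈ e.target) :
    ContDiffAt ℝ ∞ (chartNormal f e) y := by
  have h1 : ContDiffAt ℝ ∞ (fderiv ℝ (fun z => f (e.symm z))) y :=
    (contDiffAt_comp_symm he hy h.contMDiff).fderiv_right (m := ∞) (by simp)
  exact contDiff_normalForm.contDiffAt.comp (x := y)
    (f := fun y => (fderiv ℝ (fun z => f (e.symm z)) y (EuclideanSpace.single 0 1),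
      fderiv ℝ (fun z => f (e.symm z)) y (EuclideanSpace.single 1 1)))
    ((h1.clm_apply contDiffAt_const).prodMk (h1.clm_apply contDiffAt_const))

theorem chartNormal_tangent (h : BoundsConvexBody f K)
    (he : e ∈ IsManifold.maximalAtlas (𝓡 2) ∞ M) (hy : y ∈ e.target) {w : E3}
    (hw : w ∈ tangentPlane f (e.symm y)) : chartNormal f e y w = 0 := by
  obtain ⟨X, rfl⟩ := h.exists_fderiv_chart_eq he hy hw
  rw [chartNormal, normalForm_apply]
  conv_lhs => rw [e2_eq X]
  rw [map_add, map_smul, map_smul]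
  simp only [det3_eq, PiLp.add_apply, PiLp.smul_apply, smul_eq_mul]
  ring

theorem continuousOn_fderiv_chart (h : BoundsConvexBody f K)
    (he : e ∈ IsManifold.maximalAtlas (𝓡 2) ∞ M) (X : E2) :
    ContinuousOn (fun y => fderiv ℝ (fun z => f (e.symm z)) y X) e.target := fun _ hy =>
  ((((contDiffAt_comp_symm he hy h.contMDiff).fderiv_right (m := ∞) (by simp)).clm_apply
    contDiffAt_const).continuousAt).continuousWithinAt

variable [IsManifold (𝓡 2) ∞ M]

theorem det3_chart_ne_zero (hN : IsAdmissibleNorm N) (h : BoundsConvexBody f K)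
    (he : e ∈ IsManifold.maximalAtlas (𝓡 2) ∞ M) (hy : y ∈ e.target) :
    det3 (fderiv ℝ (fun z => f (e.symm z)) y (EuclideanSpace.single 0 1))
      (fderiv ℝ (fun z => f (e.symm z)) y (EuclideanSpace.single 1 1))
      (birkhoffGauss N f K (e.symm y)) ≠ 0 :=
  det3_ne_zero (h.fderiv_chart_injective he hy)
    (ℓ := fderiv ℝ N (birkhoffGauss N f K (e.symm y)))
    (fun X => h.apply_tangent (h.supports_birkhoffGauss hN _) (h.fderiv_chart_mem he hy X))
    (by rw [h.fderiv_birkhoffGauss_self hN]; exact one_ne_zero)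

/-- The Birkhoff-Gauss map is smooth. -/
theorem contDiffAt_birkhoffGauss (hN : IsAdmissibleNorm N) (h : BoundsConvexBody f K)
    (he : e ∈ IsManifold.maximalAtlas (𝓡 2) ∞ M) (hy : y ∈ e.target) :
    ContDiffAt ℝ ∞ (fun z => birkhoffGauss N f K (e.symm z)) y := by
  set v := birkhoffGauss N f K (e.symm y)
  have hv1 : N v = 1 := h.norm_birkhoffGauss hN _
  have hv0 : v ≠ 0 := h.birkhoffGauss_ne_zero hN _
  have hsupp := h.supports_birkhoffGauss hN (e.symm y)
  obtain ⟨κ, hκ⟩ := h.exists_eq_smul (p := e.symm y) (ℓ := chartNormal f e y) (by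
      intro h0
      apply h.det3_chart_ne_zero hN he hy
      rw [← normalForm_apply]
      exact congr($h0 v)) (fun w hw => h.chartNormal_tangent he hy hw)
    (fun w hw => h.apply_tangent hsupp hw)
  obtain ⟨L, hL, hLv, hLev⟩ := hN.exists_localInverse hv1
  have hm : ContDiffAt ℝ ∞ (fun z => κ • chartNormal f e z) y :=
    (h.contDiffAt_chartNormal he hy).const_smul κ
  have hLm : ContDiffAt ℝ ∞ (fun z => L (κ • chartNormal f e z)) y :=
    ContDiffAt.comp y (by rw [← hκ]; exact hL) hm
  have hval : L (κ • chartNormal f e y) = v := by rw [← hκ, hLv]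
  -- The candidate for the normal near `y`: invert `N dN` at the conormal, scaled to be correct at
  -- `y`, then normalize.
  have hψ : ContDiffAt ℝ ∞ (fun z => (N (L (κ • chartNormal f e z)))⁻¹ •
      L (κ • chartNormal f e z)) y := by
    have hNL : ContDiffAt ℝ ∞ (fun z => N (L (κ • chartNormal f e z))) y :=
      ContDiffAt.comp y (by rw [hval]; exact hN.contDiffAt hv0) hLm
    exact (hNL.inv (by rw [hval, hv1]; exact one_ne_zero)).smul hLm
  refine hψ.congr_of_eventuallyEq ?_
  obtain ⟨c, hc⟩ := h.interior_nonempty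
  -- An interior point stays on the negative side for nearby `z`; this singles out the outer of the
  -- two conormal directions.
  have hneg : ∀ᶠ z in 𝓝 y, (κ • chartNormal f e z) (c - f (e.symm z)) < 0 := by
    have hcont : ContinuousAt (fun z => (κ • chartNormal f e z) (c - f (e.symm z))) y :=
      hm.continuousAt.clm_apply
        (continuousAt_const.sub (contDiffAt_comp_symm he hy h.contMDiff).continuousAt)
    refine hcont.eventually_lt continuousAt_const ?_
    rw [← hκ, map_sub]
    linarith [hsupp.lt_of_mem_interior hc]
  have hLev' : ∀ᶠ z in 𝓝 y, N (L (κ • chartNormal f e z)) •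
      fderiv ℝ N (L (κ • chartNormal f e z)) = κ • chartNormal f e z :=
    hm.continuousAt.eventually (hκ ▸ hLev)
  filter_upwards [hneg, hLev', e.open_target.mem_nhds hy,
    hLm.continuousAt.eventually_ne (by rw [hval]; exact hv0)] with z hz1 hz2 hz3 hz0
  set x := L (κ • chartNormal f e z)
  have hx := hN.pos hz0
  have hx1 : N ((N x)⁻¹ • x) = 1 := by
    rw [map_smul_eq_mul, norm_inv, Real.norm_of_nonneg hx.le, inv_mul_cancel₀ hx.ne']
  have hdx := hN.fderiv_eq_of_smul_eq hz0
  have hx0 := IsAdmissibleNorm.ne_zero hx1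
  have hself := hN.fderiv_self hx0
  rw [hdx, hx1] at hself
  have hsx : Supports K (f (e.symm z)) (fderiv ℝ N x) := by
    have hT : ∀ w ∈ tangentPlane f (e.symm z), fderiv ℝ N x w = 0 := by
      intro w hw
      have := congr($hz2 w)
      simp only [smul_apply, h.chartNormal_tangent he hz3 hw, smul_eq_mul, mul_zero] at this
      exact (mul_eq_zero.1 this).resolve_left hx.ne'
    have hsz := h.supports_birkhoffGauss hN (e.symm z)
    obtain ⟨a, ha⟩ := h.exists_eq_smul hsz.ne_zero (fun w hw => h.apply_tangent hsz hw) hT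
    have h1 := hsz.lt_of_mem_interior hc
    rw [← hz2, ha] at hz1
    simp only [smul_apply, smul_eq_mul, map_sub] at hz1
    have ha0 : 0 < a := by
      by_contra hna
      have h2 := mul_nonneg hx.le
        (mul_nonneg_of_nonpos_of_nonpos (not_lt.1 hna) (sub_nonpos.2 h1.le))
      rw [mul_sub, mul_sub] at h2
      linarith
    rw [ha]
    refine ⟨smul_ne_zero ha0.ne' hsz.ne_zero, fun k hk => ?_⟩
    simp only [smul_apply, smul_eq_mul]
    exact mul_le_mul_of_nonneg_left (hsz.le k hk) ha0.le
  refine (h.eq_birkhoffGauss_of_supports hN hsx hx1 fun u => ?_).symm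
  rw [hself, one_mul]
  exact hN.fderiv_le hz0 u

/-- Differentiate `N ∘ η = 1`; hence `dη` takes values in the tangent plane of the surface. -/
theorem fderiv_fderiv_birkhoffGauss (hN : IsAdmissibleNorm N) (h : BoundsConvexBody f K)
    (he : e ∈ IsManifold.maximalAtlas (𝓡 2) ∞ M) (hy : y ∈ e.target) (X : E2) :
    fderiv ℝ N (birkhoffGauss N f K (e.symm y))
      (fderiv ℝ (fun z => birkhoffGauss N f K (e.symm z)) y X) = 0 := by
  have hψ := ((h.contDiffAt_birkhoffGauss hN he hy).differentiableAt (by simp)).hasFDerivAt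
  have h1 := (hN.hasFDerivAt (h.birkhoffGauss_ne_zero hN (e.symm y))).comp y hψ
  have h2 : (N ∘ fun z => birkhoffGauss N f K (e.symm z)) = fun _ => (1 : ℝ) := by
    ext z; exact h.norm_birkhoffGauss hN _
  rw [h2] at h1
  exact congr($(h1.unique (hasFDerivAt_const (1 : ℝ) y)) X)

/-- The shape operator read in a chart. -/
theorem exists_chartShape (hN : IsAdmissibleNorm N) (h : BoundsConvexBody f K)
    (he : e ∈ IsManifold.maximalAtlas (𝓡 2) ∞ M) (hy : y ∈ e.target) :
    ∃ T : E2 →ₗ[ℝ] E2,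
      (∀ X, fderiv ℝ (fun z => f (e.symm z)) y (T X)
        = fderiv ℝ (fun z => birkhoffGauss N f K (e.symm z)) y X) ∧
      LinearMap.trace ℝ E2 T = 2 * meanCurvature N f K (e.symm y) ∧
      LinearMap.det T = gaussCurvature N f K (e.symm y) := by
  set D := (chartEquiv he hy).toLinearEquiv
  set S := shapeOperator N f K (e.symm y)
  have hη := mdifferentiableAt_of_comp_symm he hy (h.contDiffAt_birkhoffGauss hN he hy)
  have hψ : ∀ X, fderiv ℝ (fun z => birkhoffGauss N f K (e.symm z)) y X
      = mfderiv (𝓡 2) 𝓘(ℝ, E3) (birkhoffGauss N f K) (e.symm y) (D X) := fun X =>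
    fderiv_comp_symm_apply he hy hη X
  -- Conjugation by the differential of the chart preserves trace and determinant.
  refine ⟨D.symm.conj S, fun X => ?_, ?_, ?_⟩
  · have hmem : fderiv ℝ (fun z => birkhoffGauss N f K (e.symm z)) y X
        ∈ tangentPlane f (e.symm y) := by
      have hsupp := h.supports_birkhoffGauss hN (e.symm y)
      rw [h.tangentPlane_eq_ker hsupp.ne_zero fun w hw => h.apply_tangent hsupp hw]
      exact h.fderiv_fderiv_birkhoffGauss hN he hy X
    obtain ⟨w, hw⟩ := hmem
    have hS : S (D X) = w := by
      change LinearMap.leftInverse (mfderiv (𝓡 2) 𝓘(ℝ, E3) f (e.symm y)).toLinearMap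
        (mfderiv (𝓡 2) 𝓘(ℝ, E3) (birkhoffGauss N f K) (e.symm y) (D X)) = w
      rw [← hψ, ← hw]
      exact LinearMap.leftInverse_apply_of_inj
        (LinearMap.ker_eq_bot.2 (h.mfderiv_injective (e.symm y))) w
    rw [h.fderiv_chart_apply he hy, ← hw]
    change mfderiv (𝓡 2) 𝓘(ℝ, E3) f (e.symm y) (D (D.symm (S (D X)))) = _
    rw [LinearEquiv.apply_symm_apply, hS]
    rfl
  · rw [LinearMap.trace_conj', meanCurvature]
    ring
  · exact LinearMap.det_conj S D.symm

theorem det3_tube (hN : IsAdmissibleNorm N) (h : BoundsConvexBody f K)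
    (he : e ∈ IsManifold.maximalAtlas (𝓡 2) ∞ M) (hy : y ∈ e.target) (t : ℝ) :
    det3 (fderiv ℝ (fun z => f (e.symm z)) y (EuclideanSpace.single 0 1)
        + t • fderiv ℝ (fun z => birkhoffGauss N f K (e.symm z)) y (EuclideanSpace.single 0 1))
      (fderiv ℝ (fun z => f (e.symm z)) y (EuclideanSpace.single 1 1)
        + t • fderiv ℝ (fun z => birkhoffGauss N f K (e.symm z)) y (EuclideanSpace.single 1 1))
      (birkhoffGauss N f K (e.symm y))
    = (1 + 2 * t * meanCurvature N f K (e.symm y) + t ^ 2 * gaussCurvature N f K (e.symm y))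
      * det3 (fderiv ℝ (fun z => f (e.symm z)) y (EuclideanSpace.single 0 1))
        (fderiv ℝ (fun z => f (e.symm z)) y (EuclideanSpace.single 1 1))
        (birkhoffGauss N f K (e.symm y)) := by
  obtain ⟨T, hT, htr, hdet⟩ := h.exists_chartShape hN he hy
  rw [det3_add_smul _ _ T hT, htr, hdet]
  ring

/-- Convexity: the Birkhoff normals turn monotonically. -/
theorem sndFDeriv_nonneg (hN : IsAdmissibleNorm N) (h : BoundsConvexBody f K)
    (he : e ∈ IsManifold.maximalAtlas (𝓡 2) ∞ M) (hy : y ∈ e.target) (X : E2) :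
    0 ≤ fderiv ℝ (fderiv ℝ N) (birkhoffGauss N f K (e.symm y))
      (fderiv ℝ (fun z => birkhoffGauss N f K (e.symm z)) y X)
      (fderiv ℝ (fun z => f (e.symm z)) y X) := by
  have hψ := ((h.contDiffAt_birkhoffGauss hN he hy).differentiableAt (by simp)).hasFDerivAt
  have h1 := (hN.hasFDerivAt_fderiv (h.birkhoffGauss_ne_zero hN (e.symm y))).comp y hψ
  have h2 := (h.hasFDerivAt_chart he hy).differentiableAt.hasFDerivAt
  refine fderiv_pairing_nonneg h1 h2 (Eventually.of_forall fun z => ?_) X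
  have h3 := (h.supports_birkhoffGauss hN (e.symm y)).le _ (h.mem (e.symm z))
  have h4 := (h.supports_birkhoffGauss hN (e.symm z)).le _ (h.mem (e.symm y))
  simp only [Function.comp_apply, sub_apply, map_sub]
  linarith

/-- The factor is 1 at `t = 0`, so it suffices that it never vanishes. A zero at `s > 0` gives `X ≠
0` with `dφ X = -s dη X`. Monotonicity makes the Hessian of `N` nonnegative on the pair `(dη X, dφ
X)`, while definiteness makes it negative. -/
theorem tube_jacobian_pos (hN : IsAdmissibleNorm N) (h : BoundsConvexBody f K)
    (he : e ∈ IsManifold.maximalAtlas (𝓡 2) ∞ M) (hy : y ∈ e.target) {t : ℝ} (ht : 0 ≤ t) :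
    0 < 1 + 2 * t * meanCurvature N f K (e.symm y)
      + t ^ 2 * gaussCurvature N f K (e.symm y) := by
  set H := meanCurvature N f K (e.symm y)
  set G := gaussCurvature N f K (e.symm y)
  have hne : ∀ s : ℝ, 0 < s → 1 + 2 * s * H + s ^ 2 * G ≠ 0 := by
    intro s hs h0
    have hdet := h.det3_tube hN he hy s
    change _ = (1 + 2 * s * H + s ^ 2 * G) * _ at hdet
    rw [h0, zero_mul] at hdet
    set A := fderiv ℝ (fun z => f (e.symm z)) y
    set B := fderiv ℝ (fun z => birkhoffGauss N f K (e.symm z)) y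
    have hA : ∀ X, fderiv ℝ N (birkhoffGauss N f K (e.symm y)) (A X) = 0 := fun X =>
      h.apply_tangent (h.supports_birkhoffGauss hN _) (h.fderiv_chart_mem he hy X)
    have hB : ∀ X, fderiv ℝ N (birkhoffGauss N f K (e.symm y)) (B X) = 0 := fun X =>
      h.fderiv_fderiv_birkhoffGauss hN he hy X
    refine det3_ne_zero (A := A + s • B) ?_
      (ℓ := fderiv ℝ N (birkhoffGauss N f K (e.symm y))) (fun X => by simp [hA, hB])
      (by rw [h.fderiv_birkhoffGauss_self hN]; exact one_ne_zero) hdet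
    rw [injective_iff_map_eq_zero]
    intro X hX
    by_contra hX0
    have hAX : A X ≠ 0 := fun h1 =>
      hX0 ((injective_iff_map_eq_zero A).1 (h.fderiv_chart_injective he hy) X h1)
    have hAB : A X = -(s • B X) := eq_neg_of_add_eq_zero_left hX
    have hBX : B X ≠ 0 := fun h1 => hAX (by rw [hAB, h1, smul_zero, neg_zero])
    have hpos := hN.sndFDeriv_pos (h.norm_birkhoffGauss hN (e.symm y)) (hB X) hBX
    have hmono := h.sndFDeriv_nonneg hN he hy X
    change 0 ≤ fderiv ℝ (fderiv ℝ N) _ (B X) (A X) at hmono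
    rw [hAB, map_neg, map_smul, smul_eq_mul] at hmono
    nlinarith [mul_pos hs hpos]
  by_contra hneg
  have hcont : ContinuousOn (fun s : ℝ => 1 + 2 * s * H + s ^ 2 * G) (Icc 0 t) := by fun_prop
  obtain ⟨s, hs, hs0⟩ := intermediate_value_Icc' ht hcont
    (show (0 : ℝ) ∈ Icc _ _ from ⟨not_lt.1 hneg, by simp⟩)
  rcases hs.1.eq_or_lt with rfl | h1
  · simp at hs0
  · exact hne s h1 hs0

theorem continuousOn_fderiv_birkhoffGauss (hN : IsAdmissibleNorm N) (h : BoundsConvexBody f K)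
    (he : e ∈ IsManifold.maximalAtlas (𝓡 2) ∞ M) (X : E2) :
    ContinuousOn (fun y => fderiv ℝ (fun z => birkhoffGauss N f K (e.symm z)) y X) e.target :=
  fun _ hy => ((((h.contDiffAt_birkhoffGauss hN he hy).fderiv_right (m := ∞) (by simp)).clm_apply
    contDiffAt_const).continuousAt).continuousWithinAt

theorem continuousOn_birkhoffGauss (hN : IsAdmissibleNorm N) (h : BoundsConvexBody f K)
    (he : e ∈ IsManifold.maximalAtlas (𝓡 2) ∞ M) :
    ContinuousOn (fun y => birkhoffGauss N f K (e.symm y)) e.target := fun _ hy =>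
  (h.contDiffAt_birkhoffGauss hN he hy).continuousAt.continuousWithinAt

theorem continuousOn_areaDensity (hN : IsAdmissibleNorm N) (h : BoundsConvexBody f K)
    (he : e ∈ IsManifold.maximalAtlas (𝓡 2) ∞ M) :
    ContinuousOn (areaDensity N f K e) e.target :=
  (continuous_det3.comp_continuousOn ((h.continuousOn_fderiv_chart he _).prodMk
    ((h.continuousOn_fderiv_chart he _).prodMk (h.continuousOn_birkhoffGauss hN he)))).abs

/-- The Jacobian of the tube map is continuous, as a function of the point of the surface. -/
theorem continuousOn_tube_jacobian (hN : IsAdmissibleNorm N) (h : BoundsConvexBody f K)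
    (he : e ∈ IsManifold.maximalAtlas (𝓡 2) ∞ M) (t : ℝ) :
    ContinuousOn (fun y => 1 + 2 * t * meanCurvature N f K (e.symm y)
      + t ^ 2 * gaussCurvature N f K (e.symm y)) e.target := by
  have hA := h.continuousOn_fderiv_chart he
  have hB := h.continuousOn_fderiv_birkhoffGauss hN he
  have hη := h.continuousOn_birkhoffGauss hN he
  have hAB : ∀ X, ContinuousOn (fun y => fderiv ℝ (fun z => f (e.symm z)) y X
      + t • fderiv ℝ (fun z => birkhoffGauss N f K (e.symm z)) y X) e.target := fun X =>
    (hA X).add ((hB X).const_smul t)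
  have hne := fun y (hy : y ∈ e.target) => h.det3_chart_ne_zero hN he hy
  have hdiv := (continuous_det3.comp_continuousOn ((hAB (EuclideanSpace.single 0 1)).prodMk
    ((hAB (EuclideanSpace.single 1 1)).prodMk hη))).div
    (continuous_det3.comp_continuousOn ((hA (EuclideanSpace.single 0 1)).prodMk
      ((hA (EuclideanSpace.single 1 1)).prodMk hη))) hne
  exact hdiv.congr fun y hy => (eq_div_iff (hne y hy)).2 (h.det3_tube hN he hy t).symm

/-- The Jacobian factors at `t = 1` and `t = -1` differ by four times the mean curvature. -/
theorem continuousOn_meanCurvature (hN : IsAdmissibleNorm N) (h : BoundsConvexBody f K)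
    (he : e ∈ IsManifold.maximalAtlas (𝓡 2) ∞ M) :
    ContinuousOn (fun y => meanCurvature N f K (e.symm y)) e.target := by
  refine (((h.continuousOn_tube_jacobian hN he 1).sub
    (h.continuousOn_tube_jacobian hN he (-1))).const_mul (1 / 4)).congr fun y _ => ?_
  simp only [Pi.sub_apply]
  ring

theorem continuousOn_gaussCurvature (hN : IsAdmissibleNorm N) (h : BoundsConvexBody f K)
    (he : e ∈ IsManifold.maximalAtlas (𝓡 2) ∞ M) :
    ContinuousOn (fun y => gaussCurvature N f K (e.symm y)) e.target := by
  refine ((((h.continuousOn_tube_jacobian hN he 1).add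
    (h.continuousOn_tube_jacobian hN he (-1))).const_mul (1 / 2)).sub
    (continuousOn_const (c := (1 : ℝ)))).congr fun y _ => ?_
  simp only [Pi.sub_apply, Pi.add_apply]
  ring

end BoundsConvexBody

/-! ### Integration over surface point and height -/

/-- The splitting `ℝ³ ≃ ℝ² × ℝ`. -/
noncomputable def splitLast : E3 ≃ᵐ E2 × ℝ :=
  (MeasurableEquiv.toLp 2 (Fin 3 → ℝ)).symm.trans
    ((MeasurableEquiv.piFinSuccAbove (fun _ : Fin 3 => ℝ) (Fin.last 2)).trans
      (MeasurableEquiv.prodComm.trans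
        (MeasurableEquiv.prodCongr (MeasurableEquiv.toLp 2 (Fin 2 → ℝ)) (MeasurableEquiv.refl ℝ))))

theorem measurePreserving_splitLast : MeasurePreserving splitLast := by
  have h1 : MeasurePreserving (MeasurableEquiv.toLp 2 (Fin 3 → ℝ)).symm :=
    EuclideanSpace.volume_preserving_symm_measurableEquiv_toLp (Fin 3)
  have h2 := volume_preserving_piFinSuccAbove (fun _ : Fin 3 => ℝ) (Fin.last 2)
  have h3 : MeasurePreserving (Prod.swap : ℝ × (Fin 2 → ℝ) → (Fin 2 → ℝ) × ℝ) :=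
    Measure.measurePreserving_swap
  have h4 : MeasurePreserving
      (Prod.map (MeasurableEquiv.toLp 2 (Fin 2 → ℝ)) (id : ℝ → ℝ)) :=
    (PiLp.volume_preserving_toLp (Fin 2)).prod (MeasurePreserving.id volume)
  exact h4.comp (h3.comp (h2.comp h1))

/-- The projection `ℝ³ → ℝ²` to the first two coordinates. -/
noncomputable def projE2 : E3 →L[ℝ] E2 :=
  (EuclideanSpace.equiv (Fin 2) ℝ).symm.toContinuousLinearMap.comp
    (ContinuousLinearMap.pi fun j : Fin 2 => (EuclideanSpace.proj j.castSucc : E3 →L[ℝ] ℝ))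

theorem projE2_apply (x : E3) (j : Fin 2) : projE2 x j = x j.castSucc := rfl

theorem splitLast_apply (x : E3) : splitLast x = (projE2 x, x 2) := by
  refine Prod.ext ?_ rfl
  ext j
  rw [projE2_apply, ← Fin.succAbove_last]
  rfl

theorem projE2_single_zero :
    projE2 (EuclideanSpace.single 0 1) = EuclideanSpace.single 0 1 := by
  ext j; fin_cases j <;> simp [projE2_apply]

theorem projE2_single_one :
    projE2 (EuclideanSpace.single 1 1) = EuclideanSpace.single 1 1 := by
  ext j; fin_cases j <;> simp [projE2_apply]

theorem projE2_single_two : projE2 (EuclideanSpace.single 2 1) = 0 := by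
  ext j; fin_cases j <;> simp [projE2_apply]

/-- Fubini for a quadratic polynomial in the last coordinate. -/
theorem integral_quadratic {s : Set E2} {ρ : ℝ} (hρ : 0 ≤ ρ) {a b c : E2 → ℝ}
    (ha : IntegrableOn a s) (hb : IntegrableOn b s) (hc : IntegrableOn c s) :
    IntegrableOn (fun z : E2 × ℝ => a z.1 + b z.1 * z.2 + c z.1 * z.2 ^ 2) (s ×ˢ Ioc 0 ρ) ∧
    ∫ z in s ×ˢ Ioc 0 ρ, (a z.1 + b z.1 * z.2 + c z.1 * z.2 ^ 2)
      = ρ * (∫ y in s, a y) + ρ ^ 2 / 2 * (∫ y in s, b y) + ρ ^ 3 / 3 * ∫ y in s, c y := by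
  have hint : ∀ (g : E2 → ℝ), IntegrableOn g s → ∀ k : ℕ,
      IntegrableOn (fun z : E2 × ℝ => g z.1 * z.2 ^ k) (s ×ˢ Ioc 0 ρ) := by
    intro g hg k
    rw [IntegrableOn, Measure.volume_eq_prod, ← Measure.prod_restrict]
    have hp : IntegrableOn (fun t : ℝ => t ^ k) (Ioc 0 ρ) :=
      (continuous_pow k).integrableOn_Ioc
    exact Integrable.mul_prod hg hp
  have hval : ∀ (g : E2 → ℝ) (k : ℕ),
      ∫ z in s ×ˢ Ioc 0 ρ, g z.1 * z.2 ^ k = (∫ y in s, g y) * (ρ ^ (k + 1) / (k + 1)) := by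
    intro g k
    rw [Measure.volume_eq_prod, setIntegral_prod_mul (μ := volume) (ν := volume) g (fun t => t ^ k),
      ← intervalIntegral.integral_of_le hρ, integral_pow]
    simp
  have ha' := hint a ha 0
  have hb' := hint b hb 1
  have hc' := hint c hc 2
  have va := hval a 0
  have vb := hval b 1
  have vc := hval c 2
  simp only [pow_zero, mul_one, pow_one] at ha' hb' va vb
  refine ⟨(ha'.add hb').add hc', ?_⟩
  have h1 := integral_add (ha'.add hb') hc'
  have h2 := integral_add ha' hb'
  simp only [Pi.add_apply] at h1 h2
  rw [h1, h2, va, vb, vc]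
  push_cast
  ring

/-- The cut-off confines the integrand to a compact subset of the chart, so the behaviour of `g`
near the boundary of `e.target` is harmless. -/
theorem integrableOn_target {M : Type*} [TopologicalSpace M] [CompactSpace M]
    {e : OpenPartialHomeomorph M E2} {χ : M → ℝ} (hχ : Continuous χ) (hsupp : tsupport χ ⊆ e.source) {g : E2 → ℝ}
    (hg : ContinuousOn g e.target) :
    IntegrableOn (fun y => χ (e.symm y) * g y) e.target := by
  have hC : IsCompact (e '' tsupport χ) :=
    (isClosed_tsupport χ).isCompact.image_of_continuousOn (e.continuousOn.mono hsupp)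
  have hsub : e '' tsupport χ ⊆ e.target := by
    rintro _ ⟨p, hp, rfl⟩
    exact e.map_source (hsupp hp)
  have hcont : ContinuousOn (fun y => χ (e.symm y) * g y) e.target :=
    (hχ.comp_continuousOn e.continuousOn_symm).mul hg
  refine IntegrableOn.of_forall_sdiff_eq_zero ((hcont.mono hsub).integrableOn_compact hC)
    e.open_target.measurableSet fun y hy => ?_
  have : e.symm y ∉ tsupport χ := fun hmem => hy.2 ⟨_, hmem, e.right_inv hy.1⟩
  rw [image_eq_zero_of_notMem_tsupport this, zero_mul]

/-! ### Change of variables along the tube -/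

namespace BoundsConvexBody

variable {M : Type*} [TopologicalSpace M] [ChartedSpace E2 M] [IsManifold (𝓡 2) ∞ M]
  {f : M → E3} {K : Set E3} {N : Seminorm ℝ E3} {e : OpenPartialHomeomorph M E2}

/-- The volume of the part of a tube over a chart, weighted by a function on the surface. -/
theorem integral_tube_chart [CompactSpace M] (hN : IsAdmissibleNorm N) (h : BoundsConvexBody f K)
    (he : e ∈ IsManifold.maximalAtlas (𝓡 2) ∞ M) {χ : M → ℝ} (hχ : Continuous χ)
    (hsupp : tsupport χ ⊆ e.source) {W : E3 → ℝ}
    (hW : ∀ p, ∀ t : ℝ, 0 < t → W (f p + t • birkhoffGauss N f K p) = χ p) {ρ : ℝ} (hρ : 0 ≤ ρ) :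
    IntegrableOn W ((K + ρ • unitBall N) \ K) ∧
    ∫ x in (K + ρ • unitBall N) \ K, W x
      = ρ * (∫ y in e.target, χ (e.symm y) * 1 * areaDensity N f K e y)
        + ρ ^ 2 * (∫ y in e.target,
            χ (e.symm y) * meanCurvature N f K (e.symm y) * areaDensity N f K e y)
        + ρ ^ 3 / 3 * ∫ y in e.target,
            χ (e.symm y) * gaussCurvature N f K (e.symm y) * areaDensity N f K e y := by
  set R := (K + ρ • unitBall N) \ K
  have hR : MeasurableSet R :=
    (h.isCompact.add (hN.isCompact_unitBall.smul ρ)).measurableSet.diff h.isCompact.measurableSet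
  -- The tube map in the chart, with the third coordinate as height: a self-map of `ℝ³`, as the
  -- change of variables requires.
  set Φ : E3 → E3 := fun x => f (e.symm (projE2 x)) + x 2 • birkhoffGauss N f K (e.symm (projE2 x))
  set A : Set E3 := splitLast ⁻¹' (e.target ×ˢ Ioc 0 ρ)
  have hA : MeasurableSet A :=
    splitLast.measurable (e.open_target.measurableSet.prod measurableSet_Ioc)
  have hAmem : ∀ x ∈ A, projE2 x ∈ e.target ∧ 0 < x 2 ∧ x 2 ≤ ρ := fun x hx => by
    have hx : splitLast x ∈ e.target ×ˢ Ioc 0 ρ := hx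
    rw [splitLast_apply] at hx
    exact ⟨hx.1, hx.2.1, hx.2.2⟩
  let Φ' : E3 → E3 →L[ℝ] E3 := fun x =>
    (fderiv ℝ (fun z => f (e.symm z)) (projE2 x)).comp projE2
      + (x 2 • (fderiv ℝ (fun z => birkhoffGauss N f K (e.symm z)) (projE2 x)).comp projE2
        + (EuclideanSpace.proj (2 : Fin 3) : E3 →L[ℝ] ℝ).smulRight
          (birkhoffGauss N f K (e.symm (projE2 x))))
  have hΦ' : ∀ x ∈ A, HasFDerivWithinAt Φ (Φ' x) A x := by
    intro x hx
    have hy := (hAmem x hx).1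
    have h1 := ((h.hasFDerivAt_chart he hy).differentiableAt.hasFDerivAt).comp x
      projE2.hasFDerivAt
    have h2 := (((h.contDiffAt_birkhoffGauss hN he hy).differentiableAt
      (by simp)).hasFDerivAt).comp x projE2.hasFDerivAt
    have h3 : HasFDerivAt (fun x : E3 => x 2) (EuclideanSpace.proj (2 : Fin 3) : E3 →L[ℝ] ℝ) x :=
      (EuclideanSpace.proj (2 : Fin 3) : E3 →L[ℝ] ℝ).hasFDerivAt
    exact (h1.add (h3.smul h2)).hasFDerivWithinAt
  have hinj : InjOn Φ A := by
    intro x hx x' hx' heq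
    obtain ⟨hy, ht, -⟩ := hAmem x hx
    obtain ⟨hy', ht', -⟩ := hAmem x' hx'
    obtain ⟨h1, h2⟩ := h.tube_injective hN ht ht' heq
    apply splitLast.injective
    rw [splitLast_apply, splitLast_apply, h2, e.symm.injOn hy hy' h1]
  have hdet : ∀ x ∈ A, |(Φ' x).det| • W (Φ x)
      = χ (e.symm (projE2 x)) * areaDensity N f K e (projE2 x)
        + χ (e.symm (projE2 x)) * (2 * meanCurvature N f K (e.symm (projE2 x))
          * areaDensity N f K e (projE2 x)) * x 2
        + χ (e.symm (projE2 x)) * (gaussCurvature N f K (e.symm (projE2 x))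
          * areaDensity N f K e (projE2 x)) * x 2 ^ 2 := by
    intro x hx
    obtain ⟨hy, ht, -⟩ := hAmem x hx
    have hd : (Φ' x).det = (1 + 2 * x 2 * meanCurvature N f K (e.symm (projE2 x))
        + x 2 ^ 2 * gaussCurvature N f K (e.symm (projE2 x)))
        * det3 (fderiv ℝ (fun z => f (e.symm z)) (projE2 x) (EuclideanSpace.single 0 1))
          (fderiv ℝ (fun z => f (e.symm z)) (projE2 x) (EuclideanSpace.single 1 1))
          (birkhoffGauss N f K (e.symm (projE2 x))) := by
      rw [← h.det3_tube hN he hy, ContinuousLinearMap.det, linearMap_det_e3]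
      simp [Φ', projE2_single_zero, projE2_single_one, projE2_single_two]
    rw [hd, hW _ _ ht, abs_mul, abs_of_pos (h.tube_jacobian_pos hN he hy ht.le), areaDensity,
      smul_eq_mul]
    ring
  have harea := h.continuousOn_areaDensity hN he
  have hH := (h.continuousOn_meanCurvature hN he).const_mul 2
  have hG := h.continuousOn_gaussCurvature hN he
  obtain ⟨hint, hval⟩ := integral_quadratic hρ (integrableOn_target hχ hsupp harea)
    (integrableOn_target hχ hsupp (hH.mul harea)) (integrableOn_target hχ hsupp (hG.mul harea))
  simp only [Pi.mul_apply] at hint hval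
  have hsub : Φ '' A ⊆ R := by
    rintro _ ⟨x, hx, rfl⟩
    obtain ⟨-, ht, ht'⟩ := hAmem x hx
    exact ⟨(h.tube_mem_add_iff hN _ ht hρ).2 ht', h.tube_notMem hN _ ht⟩
  -- A point of the shell missed by the chart has its foot outside the support of `χ`.
  have hzero : ∀ x ∈ R \ (Φ '' A), W x = 0 := by
    rintro x ⟨⟨hx1, hx2⟩, hx3⟩
    obtain ⟨p, t, ht, rfl⟩ := h.exists_tube_eq hN hx2
    rw [hW p t ht]
    refine image_eq_zero_of_notMem_tsupport fun hp => hx3 ?_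
    have hp := hsupp hp
    refine ⟨splitLast.symm (e p, t), ?_, ?_⟩
    · change splitLast (splitLast.symm (e p, t)) ∈ e.target ×ˢ Ioc 0 ρ
      rw [MeasurableEquiv.apply_symm_apply]
      exact ⟨e.map_source hp, ht, (h.tube_mem_add_iff hN p ht hρ).1 hx1⟩
    · have h1 := splitLast_apply (splitLast.symm (e p, t))
      rw [MeasurableEquiv.apply_symm_apply, Prod.ext_iff] at h1
      simp only at h1
      simp only [Φ]
      rw [← h1.1, ← h1.2, e.left_inv hp]
  have hintA : IntegrableOn (fun x => |(Φ' x).det| • W (Φ x)) A := by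
    refine IntegrableOn.congr_fun ?_ (fun x hx => (hdet x hx).symm) hA
    have := (measurePreserving_splitLast.integrableOn_comp_preimage
      splitLast.measurableEmbedding).2 hint
    simpa only [Function.comp_def, splitLast_apply] using this
  constructor
  · exact ((integrableOn_image_iff_integrableOn_abs_det_fderiv_smul volume hA hΦ' hinj W).2
      hintA).of_forall_sdiff_eq_zero hR hzero
  · rw [setIntegral_eq_of_subset_of_forall_sdiff_eq_zero hR hsub hzero,
      integral_image_eq_integral_abs_det_fderiv_smul volume hA hΦ' hinj,
      setIntegral_congr_fun hA hdet]
    have := measurePreserving_splitLast.setIntegral_preimage_emb splitLast.measurableEmbedding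
      (fun z : E2 × ℝ => χ (e.symm z.1) * areaDensity N f K e z.1
        + χ (e.symm z.1) * (2 * meanCurvature N f K (e.symm z.1) * areaDensity N f K e z.1) * z.2
        + χ (e.symm z.1) * (gaussCurvature N f K (e.symm z.1) * areaDensity N f K e z.1)
          * z.2 ^ 2) (e.target ×ˢ Ioc 0 ρ)
    simp only [splitLast_apply] at this
    rw [this, hval]
    have h2 : ∀ y, χ (e.symm y) * (2 * meanCurvature N f K (e.symm y) * areaDensity N f K e y)
        = 2 * (χ (e.symm y) * meanCurvature N f K (e.symm y) * areaDensity N f K e y) :=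
      fun y => by ring
    simp only [h2, integral_const_mul, mul_one]
    simp only [mul_assoc]
    ring

/-- The tube formula. -/
theorem volume_tube [CompactSpace M] (hN : IsAdmissibleNorm N) (h : BoundsConvexBody f K)
    {ι : Type*} (χ : SmoothPartitionOfUnity ι (𝓡 2) M)
    (e : ι → OpenPartialHomeomorph M E2) (he : ∀ i, e i ∈ IsManifold.maximalAtlas (𝓡 2) ∞ M)
    (hχ : ∀ i, tsupport (χ i) ⊆ (e i).source) {ρ : ℝ} (hρ : 0 ≤ ρ) :
    volume.real (K + ρ • unitBall N)
      = volume.real K + ρ * surfaceArea N f K χ e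
        + ρ ^ 2 * surfaceIntegral N f K χ e (meanCurvature N f K)
        + ρ ^ 3 / 3 * surfaceIntegral N f K χ e (gaussCurvature N f K) := by
  have hKc := h.isCompact
  have hKρ : IsCompact (K + ρ • unitBall N) := hKc.add (hN.isCompact_unitBall.smul ρ)
  have hsub : K ⊆ K + ρ • unitBall N := fun x hx =>
    (mem_add_smul_unitBall hN hρ).2 ⟨x, hx, by simpa using hρ⟩
  have hfin : {i | (Function.support (χ i)).Nonempty}.Finite :=
    χ.locallyFinite.finite_nonempty_of_compact
  set s := hfin.toFinset
  have hs : ∀ i, i ∉ s → ∀ p, χ i p = 0 := by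
    intro i hi p
    by_contra hne
    exact hi (hfin.mem_toFinset.2 ⟨p, hne⟩)
  have hsum : ∀ p, ∑ i ∈ s, χ i p = 1 := by
    intro p
    rw [← χ.sum_eq_one (mem_univ p)]
    refine (finsum_eq_sum_of_support_subset _ fun i hi => ?_).symm
    by_contra hne
    exact hi (hs i hne p)
  have hsurf : ∀ g : M → ℝ, surfaceIntegral N f K χ e g = ∑ i ∈ s, ∫ y in (e i).target,
      χ i ((e i).symm y) * g ((e i).symm y) * areaDensity N f K (e i) y := by
    intro g
    refine finsum_eq_sum_of_support_subset _ fun i hi => ?_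
    by_contra hne
    refine hi ?_
    simp [hs i hne]
  set P : M × Ioi (0 : ℝ) → E3 := fun q => f q.1 + (q.2 : ℝ) • birkhoffGauss N f K q.1
  have hP : Function.Injective P := by
    rintro ⟨p, t, ht⟩ ⟨q, t', ht'⟩ heq
    obtain ⟨rfl, rfl⟩ := h.tube_injective hN ht ht' heq
    rfl
  -- `χ i` made constant along the normals; the default value 0 is taken only on `K`.
  set W : ι → E3 → ℝ := fun i => Function.extend P (fun q => χ i q.1) 0
  have hW : ∀ i p, ∀ t : ℝ, 0 < t → W i (f p + t • birkhoffGauss N f K p) = χ i p :=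
    fun i p t ht => hP.extend_apply _ _ (⟨p, t, ht⟩ : M × Ioi (0 : ℝ))
  have key := fun i => h.integral_tube_chart hN (he i) (χ i).contMDiff.continuous (hχ i)
    (hW i) hρ
  have hvol : volume.real ((K + ρ • unitBall N) \ K)
      = ∑ i ∈ s, ∫ x in (K + ρ • unitBall N) \ K, W i x := by
    rw [← integral_finsetSum _ fun i _ => (key i).1]
    rw [setIntegral_congr_fun (hKρ.measurableSet.diff hKc.measurableSet)
      (g := fun _ => (1 : ℝ)) fun x hx => ?_]
    · simp
    · obtain ⟨p, t, ht, rfl⟩ := h.exists_tube_eq hN hx.2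
      simp only [hW _ _ _ ht, hsum]
  have hdiff := measureReal_sdiff hsub hKc.measurableSet (μ := volume)
    hKρ.measure_lt_top.ne
  rw [hvol, Finset.sum_congr rfl fun i _ => (key i).2, Finset.sum_add_distrib,
    Finset.sum_add_distrib, ← Finset.mul_sum, ← Finset.mul_sum, ← Finset.mul_sum] at hdiff
  rw [surfaceArea, hsurf, hsurf, hsurf]
  linarith

end BoundsConvexBody

/-! ### From the volume polynomial to the mixed volumes -/

theorem volume_real_smul (s : Set E3) {r : ℝ} (hr : 0 ≤ r) :
    volume.real (r • s) = r ^ 3 * volume.real s := by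
  have h : Module.finrank ℝ E3 = 3 := finrank_euclideanSpace_fin
  rw [Measure.real, Measure.addHaar_smul, h, abs_of_nonneg (by positivity),
    ENNReal.toReal_mul, ENNReal.toReal_ofReal (by positivity), Measure.real]

theorem convex_unitBall (N : Seminorm ℝ E3) : Convex ℝ (unitBall N) := by
  have : unitBall N = N.closedBall 0 1 := by
    ext x; simp [unitBall, Seminorm.mem_closedBall]
  rw [this]
  exact N.convex_closedBall 0 1

/-- If the volume of the parallel bodies is a cubic polynomial, its leading coefficient is the
volume of the ball. -/
theorem leading_coeff_eq_volume {N : Seminorm ℝ E3} (hN : IsAdmissibleNorm N) {K : Set E3}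
    (hK : IsCompact K) (hne : K.Nonempty) {a b c d : ℝ}
    (hP : ∀ ρ : ℝ, 0 ≤ ρ →
      volume.real (K + ρ • unitBall N) = a + b * ρ + c * ρ ^ 2 + d * ρ ^ 3) :
    d = volume.real (unitBall N) := by
  set V := volume.real (unitBall N)
  obtain ⟨x, hx⟩ := hne
  obtain ⟨R, hR⟩ := (hK.image (continuous_seminorm N)).bddAbove
  have hR : ∀ y ∈ K, N y ≤ R := fun y hy => hR ⟨y, hy, rfl⟩
  have hR0 : 0 ≤ R := (apply_nonneg N x).trans (hR x hx)
  have hKρ : ∀ ρ : ℝ, IsCompact (K + ρ • unitBall N) := fun ρ =>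
    hK.add (hN.isCompact_unitBall.smul ρ)
  -- Sandwich `{x} + ρB ⊆ K + ρB ⊆ (R + ρ)B`; dividing by `ρ³` and letting `ρ → ∞` leaves `d = V`.
  have hlow : ∀ ρ : ℝ, 0 ≤ ρ → ρ ^ 3 * V ≤ a + b * ρ + c * ρ ^ 2 + d * ρ ^ 3 := by
    intro ρ hρ
    rw [← hP ρ hρ, ← volume_real_smul _ hρ]
    have h1 : volume.real (ρ • unitBall N) = volume.real ({x} + ρ • unitBall N) := by
      rw [singleton_add, image_add_left, Measure.real, Measure.real, measure_preimage_add]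
    rw [h1]
    exact measureReal_mono (add_subset_add_right (singleton_subset_iff.2 hx))
      (hKρ ρ).measure_lt_top.ne
  have hup : ∀ ρ : ℝ, 0 ≤ ρ → a + b * ρ + c * ρ ^ 2 + d * ρ ^ 3 ≤ (R + ρ) ^ 3 * V := by
    intro ρ hρ
    rw [← hP ρ hρ, ← volume_real_smul _ (by positivity)]
    refine measureReal_mono ?_ (hN.isCompact_unitBall.smul (R + ρ)).measure_lt_top.ne
    rw [(convex_unitBall N).add_smul hR0 hρ]
    refine add_subset_add_right fun y hy => ?_
    have := (mem_add_smul_unitBall (K := {0}) hN hR0 (x := y)).2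
      ⟨0, rfl, by simpa using hR y hy⟩
    simpa using this
  have hinv : Tendsto (fun ρ : ℝ => ρ⁻¹) atTop (𝓝 0) := tendsto_inv_atTop_zero
  have hl : Tendsto (fun ρ : ℝ => a * ρ⁻¹ ^ 3 + b * ρ⁻¹ ^ 2 + c * ρ⁻¹ + d) atTop (𝓝 d) := by
    have h := (by fun_prop : Continuous fun u : ℝ => a * u ^ 3 + b * u ^ 2 + c * u + d).tendsto 0
    simp only [ne_eq, OfNat.ofNat_ne_zero, not_false_eq_true, zero_pow, mul_zero, zero_add] at h
    exact h.comp hinv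
  have hr : Tendsto (fun ρ : ℝ => (R * ρ⁻¹ + 1) ^ 3 * V) atTop (𝓝 V) := by
    have h := (by fun_prop : Continuous fun u : ℝ => (R * u + 1) ^ 3 * V).tendsto 0
    simp only [mul_zero, zero_add, one_pow, one_mul] at h
    exact h.comp hinv
  refine le_antisymm (le_of_tendsto_of_tendsto hl hr ?_) (ge_of_tendsto hl ?_)
  · filter_upwards [eventually_gt_atTop 0] with ρ hρ
    have h := mul_le_mul_of_nonneg_left (hup ρ hρ.le) (by positivity : 0 ≤ ρ⁻¹ ^ 3)
    convert h using 1 <;> field_simp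
  · filter_upwards [eventually_gt_atTop 0] with ρ hρ
    have h := mul_le_mul_of_nonneg_left (hlow ρ hρ.le) (by positivity : 0 ≤ ρ⁻¹ ^ 3)
    convert h using 1 <;> field_simp

theorem mixedVolume_eq (A : Fin 3 → Set E3) : mixedVolume A = (1 / 6) *
    (volume.real (A 0) + volume.real (A 1) + volume.real (A 2)
      - volume.real (A 0 + A 1) - volume.real (A 0 + A 2) - volume.real (A 1 + A 2)
      + volume.real (A 0 + A 1 + A 2)) := by
  have h : (Finset.univ : Finset (Finset (Fin 3))).erase ∅
      = {{0}, {1}, {2}, {0, 1}, {0, 2}, {1, 2}, {0, 1, 2}} := by decide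
  rw [mixedVolume, h]
  repeat rw [Finset.sum_insert (by decide)]
  simp only [Finset.sum_singleton, Finset.card_singleton]
  have c1 : ({0, 1} : Finset (Fin 3)).card = 2 := by decide
  have c2 : ({0, 2} : Finset (Fin 3)).card = 2 := by decide
  have c3 : ({1, 2} : Finset (Fin 3)).card = 2 := by decide
  have c4 : ({0, 1, 2} : Finset (Fin 3)).card = 3 := by decide
  have s4 : ∑ i ∈ ({0, 1, 2} : Finset (Fin 3)), A i = A 0 + A 1 + A 2 := by
    rw [Finset.sum_insert (by decide), Finset.sum_insert (by decide), Finset.sum_singleton,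
      add_assoc]
  rw [c1, c2, c3, c4, s4]
  norm_num
  ring

/-- The intrinsic volumes are read off from the volume polynomial of the parallel bodies. -/
theorem intrinsicVolume_eq_of_polynomial {K B : Set E3} (hK : Convex ℝ K) (hB : Convex ℝ B)
    {a b c d : ℝ}
    (hP : ∀ ρ : ℝ, 0 ≤ ρ → volume.real (K + ρ • B) = a + b * ρ + c * ρ ^ 2 + d * ρ ^ 3)
    (ha : volume.real K = a) (hd : volume.real B = d) :
    intrinsicVolume 3 K B = a ∧ 3 * intrinsicVolume 2 K B = b ∧
      3 * intrinsicVolume 1 K B = c ∧ intrinsicVolume 0 K B = d := by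
  have two : ∀ {S : Set E3}, Convex ℝ S → S + S = (2 : ℝ) • S := fun {S} hS => by
    have h := hS.add_smul (p := 1) (q := 1) zero_le_one zero_le_one
    rw [one_add_one_eq_two, one_smul] at h
    exact h.symm
  have three : ∀ {S : Set E3}, Convex ℝ S → S + S + S = (3 : ℝ) • S := fun {S} hS => by
    have h := hS.add_smul (p := 2) (q := 1) zero_le_two zero_le_one
    rw [two_add_one_eq_three, one_smul] at h
    rw [two hS, h]
  have hKK : volume.real (K + K) = 8 * a := by
    rw [two hK, volume_real_smul _ zero_le_two, ha]; norm_num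
  have hKKK : volume.real (K + K + K) = 27 * a := by
    rw [three hK, volume_real_smul _ zero_le_three, ha]; norm_num
  have hBB : volume.real (B + B) = 8 * d := by
    rw [two hB, volume_real_smul _ zero_le_two, hd]; norm_num
  have hBBB : volume.real (B + B + B) = 27 * d := by
    rw [three hB, volume_real_smul _ zero_le_three, hd]; norm_num
  have hKB : volume.real (K + B) = a + b + c + d := by
    simpa using hP 1 zero_le_one
  have hKBB : volume.real (K + B + B) = a + 2 * b + 4 * c + 8 * d := by
    rw [add_assoc, two hB, hP 2 zero_le_two]; ring
  have hKKB : volume.real (K + K + B) = 8 * a + 4 * b + 2 * c + d := by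
    -- Two copies of `K` become a dilated parallel body, at radius `1 / 2`.
    have : K + K + B = (2 : ℝ) • (K + (1 / 2 : ℝ) • B) := by
      rw [smul_add, smul_smul, two hK]; norm_num
    rw [this, volume_real_smul _ zero_le_two, hP _ (by norm_num)]
    ring
  simp only [intrinsicVolume, mixedVolume_eq]
  simp [hKK, hKKK, hBB, hBBB, hKB, hKBB, hKKB, ha, hd]
  refine ⟨?_, ?_, ?_, ?_⟩ <;> ring

end NormedSurface

theorem corollary3p1
    -- the norm of the ambient space
    (N : Seminorm ℝ E3) (hN : IsAdmissibleNorm N)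
    -- a compact surface without boundary, smoothly embedded by `f`
    {M : Type*} [TopologicalSpace M] [T2Space M] [CompactSpace M]
    [ChartedSpace E2 M] [IsManifold (𝓡 2) ∞ M]
    (f : M → E3) (hf : ContMDiff (𝓡 2) 𝓘(ℝ, E3) ∞ f)
    (himm : ∀ p, Function.Injective (mfderiv (𝓡 2) 𝓘(ℝ, E3) f p))
    (hinj : Function.Injective f)
    -- it encloses the convex region `K`
    (K : Set E3) (hK : IsCompact K) (hconv : Convex ℝ K)
    (hint : (interior K).Nonempty) (hbd : Set.range f = frontier K)
    -- any charts and any subordinate partition of unity, to compute integrals over the surface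
    {ι : Type*} (χ : SmoothPartitionOfUnity ι (𝓡 2) M)
    (e : ι → OpenPartialHomeomorph M E2)
    (he : ∀ i, e i ∈ IsManifold.maximalAtlas (𝓡 2) ∞ M)
    (hχ : ∀ i, tsupport (χ i) ⊆ (e i).source) :
    -- the volume of the parallel bodies, explicitly
    (∀ ρ : ℝ, 0 ≤ ρ → volume.real (K + ρ • unitBall N)
      = volume.real K + ρ * surfaceArea N f K χ e
        + ρ ^ 2 * surfaceIntegral N f K χ e (meanCurvature N f K)
        + ρ ^ 3 / 3 * surfaceIntegral N f K χ e (gaussCurvature N f K)) ∧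
    -- the Steiner formula, and the values of the intrinsic volumes in it
    (∀ ρ : ℝ, 0 ≤ ρ → volume.real (K + ρ • unitBall N)
      = ∑ j ∈ Finset.range 4,
          ρ ^ (3 - j) * (Nat.choose 3 j : ℝ) * intrinsicVolume j K (unitBall N)) ∧
    intrinsicVolume 3 K (unitBall N) = volume.real K ∧
    3 * intrinsicVolume 2 K (unitBall N) = surfaceArea N f K χ e ∧
    3 * intrinsicVolume 1 K (unitBall N) = surfaceIntegral N f K χ e (meanCurvature N f K) ∧
    3 * intrinsicVolume 0 K (unitBall N) = surfaceIntegral N f K χ e (gaussCurvature N f K) := by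
  have h : BoundsConvexBody f K := ⟨hf, himm, hinj, hK, hconv, hint, hbd⟩
  have htube := fun (ρ : ℝ) (hρ : 0 ≤ ρ) => h.volume_tube hN χ e he hχ hρ
  have hpoly : ∀ ρ : ℝ, 0 ≤ ρ → volume.real (K + ρ • unitBall N)
      = volume.real K + surfaceArea N f K χ e * ρ
        + surfaceIntegral N f K χ e (meanCurvature N f K) * ρ ^ 2
        + (1 / 3 * surfaceIntegral N f K χ e (gaussCurvature N f K)) * ρ ^ 3 := fun ρ hρ => by
    rw [htube ρ hρ]; ring
  -- The tube formula alone does not identify the total Gaussian curvature with three times the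
  -- volume of `B`; growth at infinity does.
  have hlead := leading_coeff_eq_volume hN hK (hint.mono interior_subset) hpoly
  obtain ⟨h3, h2, h1, h0⟩ := intrinsicVolume_eq_of_polynomial hconv (convex_unitBall N) hpoly rfl
    hlead.symm
  refine ⟨htube, fun ρ hρ => ?_, h3, h2, h1, by rw [h0]; ring⟩
  rw [hpoly ρ hρ, ← h2, ← h1, ← h0]
  have c1 : Nat.choose 3 1 = 3 := by decide
  have c2 : Nat.choose 3 2 = 3 := by decide
  simp only [Finset.sum_range_succ, Finset.sum_range_zero, Nat.choose_zero_right,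
    Nat.choose_self, c1, c2, h3]
  push_cast
  ring
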